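/- Let $k$ be an algebraically closed field with $\operatorname{char} k\neq 2$. Let $D_4$ be the Drinfeld double of Sweedler's 4-dimensional Hopf algebra, that is, the Hopf algebra over $k$ generated by $a,b,c,d$ with relations $$ba=-ab,\quad db=-bd,\quad ca=-ac,\quad dc=-cd,\quad bc=cb,\quad a^2=d^2=0,\quad b^2=c^2=1,\quad da+ad=1-bc,$$ coproduct $\Delta(a)=a\otimes b+1\otimes a$, $\Delta(b)=b\otimes b$, $\Delta(c)=c\otimes c$, $\Delta(d)=d\otimes c+1\otimes d$ and counit $\varepsilon(a)=\varepsilon(d)=0$, $\varepsilon(b)=\varepsilon(c)=1$. All modules are finite dimensional left $D_4$-modules, $\otimes=\otimes_k$ with $D_4$ acting through $\Delta$, and $nM$ is the direct sum of $n$ copies of $M$. For $r\in\mathbb Z/2$: - $V(r)$ is the one-dimensional module on which $a,d$ act by $0$ and $b,c$ act by $(-1)^r$. - $P(r)$ is the projective cover of $V(r)$; it has a basis $v_1,v_2,v_3,v_4$ with $av_1=v_2$, $av_3=v_4$, $av_2=av_4=0$, $dv_1=v_3$, $dv_2=-v_4$, $dv_3=dv_4=0$, where $b,c$ act by $(-1)^r$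 on $v_1,v_4$ and by $(-1)^{r+1}$ on $v_2,v_3$. - $\Omega^sV(r)$, $s\ge 1$, is the $s$-th syzygy of $V(r)$: $\Omega^0V(r)=V(r)$, and $\Omega^{s}V(r)$ is the kernel of the projective cover of $\Omega^{s-1}V(r)$. - For $t\ge 1$ and $\eta\in\mathbb P^1(k)=k\cup\{\infty\}$, $M_t(r,\eta)$ is the module with basis $v_1,\dots,v_t,w_1,\dots,w_t$ on which $b,c$ act by $(-1)^{r+1}$ on the $v_i$ and by $(-1)^r$ on the $w_i$, $aw_i=dw_i=0$, and, with $w_0=0$, $av_i=w_i$ and $dv_i=-\eta w_i-w_{i-1}$ if $\eta\in k$, while $av_i=w_{i-1}$ and $dv_i=w_i$ if $\eta=\infty$. (Up to isomorphism it is the unique indecomposable module of Loewy length $2$, with socle and top both of length $t$, that contains $M_1(r,\eta)$.) **Corollary 2.22.** Let $s,t\ge 1$, $r,r'\in\mathbb Z/2$ and $\eta\in\mathbb P^1(k)$. Then, as $D_4$-modules: 1. If $s$ is odd, $M_t(r,\eta)\otimes\Omega^sV(r')\cong st\,P(r+r')\oplus M_t(r+r'+1,\eta)$. 2. If $s$ is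 even, $M_t(r,\eta)\otimes\Omega^sV(r')\cong st\,P(r+r'+1)\oplus M_t(r+r',\eta)$. -/

import Mathlib

open scoped TensorProduct

universe u

/-! The Drinfeld double of Sweedler's Hopf algebra, by generators and relations -/

namespace D4

/-- The four generators. -/
inductive Gen : Type
  | a | b | c | d

/-- A generator as an element of the free algebra. -/
noncomputable abbrev fr (k : Type u) [Field k] (x : Gen) : FreeAlgebra k Gen := FreeAlgebra.ι k x

/-- The defining relations `ba = -ab`, `db = -bd`, `ca = -ac`, `dc = -cd`, `bc = cb`,
`a² = 0`, `b² = 1`, `c² = 1`, `d² = 0`, `da + ad = 1 - bc`. -/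
inductive Rel (k : Type u) [Field k] : FreeAlgebra k Gen → FreeAlgebra k Gen → Prop
  | ba : Rel k (fr k .b * fr k .a) (-(fr k .a * fr k .b))
  | db : Rel k (fr k .d * fr k .b) (-(fr k .b * fr k .d))
  | ca : Rel k (fr k .c * fr k .a) (-(fr k .a * fr k .c))
  | dc : Rel k (fr k .d * fr k .c) (-(fr k .c * fr k .d))
  | bc : Rel k (fr k .b * fr k .c) (fr k .c * fr k .b)
  | aa : Rel k (fr k .a * fr k .a) 0
  | bb : Rel k (fr k .b * fr k .b) 1
  | cc : Rel k (fr k .c * fr k .c) 1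
  | dd : Rel k (fr k .d * fr k .d) 0
  | da : Rel k (fr k .d * fr k .a + fr k .a * fr k .d) (1 - fr k .b * fr k .c)

end D4

/-- The algebra `D₄` over `k`. -/
def D4 (k : Type u) [Field k] : Type u := RingQuot (D4.Rel k)

namespace D4

noncomputable instance (k : Type u) [Field k] : Ring (D4 k) :=
  inferInstanceAs (Ring (RingQuot (D4.Rel k)))

noncomputable instance (k : Type u) [Field k] : Algebra k (D4 k) :=
  inferInstanceAs (Algebra k (RingQuot (D4.Rel k)))

/-- The quotient map from the free algebra. -/
noncomputable def proj (k : Type u) [Field k] : FreeAlgebra k Gen →ₐ[k] D4 k :=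
  RingQuot.mkAlgHom k (Rel k)

theorem proj_rel {k : Type u} [Field k] {x y : FreeAlgebra k Gen} (h : Rel k x y) :
    proj k x = proj k y :=
  RingQuot.mkAlgHom_rel k h

/-- A generator as an element of `D₄`. -/
noncomputable def gen (k : Type u) [Field k] (x : Gen) : D4 k := proj k (fr k x)

/-- Four elements `f a, f b, f c, f d` of a `k`-algebra satisfy the defining relations of `D₄`. -/
structure Relations {A : Type*} [Ring A] (f : Gen → A) : Prop where
  ba : f .b * f .a = -(f .a * f .b)
  db : f .d * f .b = -(f .b * f .d)
  ca : f .c * f .a = -(f .a * f .c)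
  dc : f .d * f .c = -(f .c * f .d)
  bc : f .b * f .c = f .c * f .b
  aa : f .a * f .a = 0
  bb : f .b * f .b = 1
  cc : f .c * f .c = 1
  dd : f .d * f .d = 0
  da : f .d * f .a + f .a * f .d = 1 - f .b * f .c

theorem gen_relations (k : Type u) [Field k] : Relations (gen k) := by
  constructor
  · simpa [gen] using proj_rel (Rel.ba (k := k))
  · simpa [gen] using proj_rel (Rel.db (k := k))
  · simpa [gen] using proj_rel (Rel.ca (k := k))
  · simpa [gen] using proj_rel (Rel.dc (k := k))
  · simpa [gen] using proj_rel (Rel.bc (k := k))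
  · simpa [gen] using proj_rel (Rel.aa (k := k))
  · simpa [gen] using proj_rel (Rel.bb (k := k))
  · simpa [gen] using proj_rel (Rel.cc (k := k))
  · simpa [gen] using proj_rel (Rel.dd (k := k))
  · simpa [gen] using proj_rel (Rel.da (k := k))

/-- The algebra map out of `D₄` given by four elements satisfying the relations. -/
noncomputable def lift {k : Type u} [Field k] {A : Type*} [Ring A] [Algebra k A] (f : Gen → A)
    (h : Relations f) : D4 k →ₐ[k] A :=
  RingQuot.liftAlgHom k ⟨FreeAlgebra.lift k f, by
    intro x y hxy
    cases hxy
    · simpa using h.ba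
    · simpa using h.db
    · simpa using h.ca
    · simpa using h.dc
    · simpa using h.bc
    · simpa using h.aa
    · simpa using h.bb
    · simpa using h.cc
    · simpa using h.dd
    · simpa using h.da⟩

@[simp] theorem lift_gen {k : Type u} [Field k] {A : Type*} [Ring A] [Algebra k A] (f : Gen → A)
    (h : Relations f) (x : Gen) : lift f h (gen k x) = f x := by
  unfold lift gen
  exact (RingQuot.liftAlgHom_mkAlgHom_apply k _ _ _).trans (by simp)

theorem algHom_ext {k : Type u} [Field k] {A : Type*} [Ring A] [Algebra k A]
    {f g : D4 k →ₐ[k] A} (h : ∀ x, f (gen k x) = g (gen k x)) : f = g := by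
  apply RingQuot.ringQuot_ext' k
  ext x
  exact h x

/-- The coproduct on generators: `a ↦ a ⊗ b + 1 ⊗ a`, `b ↦ b ⊗ b`, `c ↦ c ⊗ c`,
`d ↦ d ⊗ c + 1 ⊗ d`. -/
noncomputable def comulGen (k : Type u) [Field k] : Gen → D4 k ⊗[k] D4 k
  | .a => gen k .a ⊗ₜ gen k .b + 1 ⊗ₜ gen k .a
  | .b => gen k .b ⊗ₜ gen k .b
  | .c => gen k .c ⊗ₜ gen k .c
  | .d => gen k .d ⊗ₜ gen k .c + 1 ⊗ₜ gen k .d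

theorem comulGen_relations (k : Type u) [Field k] : Relations (comulGen k) := by
  have h := gen_relations k
  constructor
  · simp [comulGen, mul_add, add_mul, h.ba, TensorProduct.neg_tmul, TensorProduct.tmul_neg]
    abel
  · simp [comulGen, mul_add, add_mul, h.db, ← h.bc, TensorProduct.neg_tmul, TensorProduct.tmul_neg]
    abel
  · simp [comulGen, mul_add, add_mul, h.ca, h.bc, TensorProduct.neg_tmul, TensorProduct.tmul_neg]
    abel
  · simp [comulGen, mul_add, add_mul, h.dc, TensorProduct.neg_tmul, TensorProduct.tmul_neg]
    abel
  · simp [comulGen, h.bc]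
  · simp [comulGen, mul_add, add_mul, h.ba, h.aa, TensorProduct.tmul_neg]
  · simp [comulGen, h.bb, Algebra.TensorProduct.one_def]
  · simp [comulGen, h.cc, Algebra.TensorProduct.one_def]
  · simp [comulGen, mul_add, add_mul, h.dc, h.dd, TensorProduct.tmul_neg]
  · have e1 : gen k .d * gen k .a = 1 - gen k .b * gen k .c - gen k .a * gen k .d := by
      rw [← h.da]; abel
    simp [comulGen, mul_add, add_mul, e1, h.ca, h.db, ← h.bc, TensorProduct.tmul_neg,
      TensorProduct.sub_tmul, TensorProduct.tmul_sub, Algebra.TensorProduct.one_def]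
    abel

/-- The counit on generators. -/
def counitGen (k : Type u) [Field k] : Gen → k
  | .a => 0
  | .b => 1
  | .c => 1
  | .d => 0

theorem counitGen_relations (k : Type u) [Field k] : Relations (counitGen k) := by
  constructor <;> simp [counitGen]

/-- The bialgebra structure of `D₄`. (A bialgebra has at most one antipode, and the antipode plays
no role for tensor products of modules.) -/
noncomputable instance (k : Type u) [Field k] : Bialgebra k (D4 k) :=
  Bialgebra.ofAlgHom (lift (comulGen k) (comulGen_relations k))
    (lift (counitGen k) (counitGen_relations k))
    (by
      apply algHom_ext
      rintro (_ | _ | _ | _) <;>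
        simp [comulGen, TensorProduct.add_tmul, TensorProduct.tmul_add,
          Algebra.TensorProduct.one_def, add_assoc])
    (by
      apply algHom_ext
      rintro (_ | _ | _ | _) <;> simp [comulGen, counitGen])
    (by
      apply algHom_ext
      rintro (_ | _ | _ | _) <;> simp [comulGen, counitGen])

/-- The monomial `a^i b^j c^l d^m`. -/
noncomputable def mono (k : Type u) [Field k] (i j l m : Fin 2) : D4 k :=
  gen k .a ^ i.val * gen k .b ^ j.val * gen k .c ^ l.val * gen k .d ^ m.val

/-- `D₄` is finite dimensional: it is spanned by the 16 monomials `a^i b^j c^l d^m`. -/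
instance finite (k : Type u) [Field k] : Module.Finite k (D4 k) := by
  have h := gen_relations k
  set S : Submodule k (D4 k) := Submodule.span k
    (Set.range fun p : Fin 2 × Fin 2 × Fin 2 × Fin 2 => mono k p.1 p.2.1 p.2.2.1 p.2.2.2) with hS
  have mem : ∀ i j l m : Fin 2, mono k i j l m ∈ S := fun i j l m =>
    Submodule.subset_span ⟨(i, j, l, m), rfl⟩
  have da : gen k .d * gen k .a = 1 - gen k .b * gen k .c - gen k .a * gen k .d := by
    rw [← h.da]; abel
  have ba' : ∀ z, gen k .b * (gen k .a * z) = -(gen k .a * (gen k .b * z)) := fun z => by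
    rw [← mul_assoc, h.ba, neg_mul, mul_assoc]
  have ca' : ∀ z, gen k .c * (gen k .a * z) = -(gen k .a * (gen k .c * z)) := fun z => by
    rw [← mul_assoc, h.ca, neg_mul, mul_assoc]
  have db' : ∀ z, gen k .d * (gen k .b * z) = -(gen k .b * (gen k .d * z)) := fun z => by
    rw [← mul_assoc, h.db, neg_mul, mul_assoc]
  have dc' : ∀ z, gen k .d * (gen k .c * z) = -(gen k .c * (gen k .d * z)) := fun z => by
    rw [← mul_assoc, h.dc, neg_mul, mul_assoc]
  have cb' : ∀ z, gen k .c * (gen k .b * z) = gen k .b * (gen k .c * z) := fun z => by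
    rw [← mul_assoc, ← h.bc, mul_assoc]
  have aa' : ∀ z, gen k .a * (gen k .a * z) = 0 := fun z => by
    rw [← mul_assoc, h.aa, zero_mul]
  have bb' : ∀ z, gen k .b * (gen k .b * z) = z := fun z => by
    rw [← mul_assoc, h.bb, one_mul]
  have cc' : ∀ z, gen k .c * (gen k .c * z) = z := fun z => by
    rw [← mul_assoc, h.cc, one_mul]
  have da' : ∀ z, gen k .d * (gen k .a * z) =
      z - gen k .b * (gen k .c * z) - gen k .a * (gen k .d * z) := fun z => by
    rw [← mul_assoc, da, sub_mul, sub_mul, one_mul, mul_assoc, mul_assoc]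
  have mem' := mem
  simp only [Fin.forall_fin_two, mono, Fin.val_zero, Fin.val_one, pow_zero, pow_one, one_mul,
    mul_one, mul_assoc] at mem'
  have hmono : ∀ (x : Gen) (i j l m : Fin 2), gen k x * mono k i j l m ∈ S := by
    rintro (_ | _ | _ | _) <;>
    simp only [Fin.forall_fin_two, mono, Fin.val_zero, Fin.val_one, pow_zero, pow_one, one_mul,
      mul_one, mul_assoc, h.ba, h.ca, h.db, h.dc, ← h.bc, h.aa, h.bb, h.cc, h.dd, da, ba', ca',
      db', dc', cb', aa', bb', cc', da', mul_neg, neg_neg, mul_zero, neg_zero, sub_zero] <;>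
    simp only [mem', Submodule.neg_mem_iff, Submodule.zero_mem, Submodule.sub_mem, and_self]
  have hgen : ∀ (x : Gen), ∀ s ∈ S, gen k x * s ∈ S := by
    intro x s hs
    induction hs using Submodule.span_induction with
    | mem s hs => obtain ⟨p, rfl⟩ := hs; exact hmono x _ _ _ _
    | zero => simp
    | add s t _ _ hs ht => rw [mul_add]; exact S.add_mem hs ht
    | smul r s _ hs => rw [mul_smul_comm]; exact S.smul_mem r hs
  have hall : ∀ (z : FreeAlgebra k Gen), ∀ s ∈ S, proj k z * s ∈ S := by
    intro z
    induction z using FreeAlgebra.induction with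
    | grade0 r =>
      intro s hs
      rw [AlgHom.commutes, ← Algebra.smul_def]
      exact S.smul_mem r hs
    | grade1 x => exact hgen x
    | mul y z hy hz => intro s hs; rw [map_mul, mul_assoc]; exact hy _ (hz _ hs)
    | add y z hy hz => intro s hs; rw [map_add, add_mul]; exact S.add_mem (hy _ hs) (hz _ hs)
  have htop : S = ⊤ := by
    rw [eq_top_iff]
    rintro x -
    obtain ⟨z, rfl⟩ : ∃ z, proj k z = x := RingQuot.mkAlgHom_surjective k (Rel k) x
    have := hall z (mono k 0 0 0 0) (mem _ _ _ _)
    simpa [mono] using this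
  exact ⟨by rw [← htop]; exact Submodule.fg_span (Set.finite_range _)⟩

end D4

/-- A finite dimensional left module over `D₄`. -/
structure D4Mod (k : Type u) [Field k] where
  /-- The underlying vector space. -/
  carrier : Type u
  [addCommGroup : AddCommGroup carrier]
  [kModule : Module k carrier]
  [d4Module : Module (D4 k) carrier]
  [isScalarTower : IsScalarTower k (D4 k) carrier]
  [finiteDimensional : Module.Finite k carrier]

namespace D4Mod

instance (k : Type u) [Field k] : CoeSort (D4Mod k) (Type u) := ⟨carrier⟩

attribute [instance] addCommGroup kModule d4Module isScalarTower finiteDimensional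

section Constructions

variable {k : Type u} [Field k]

/-- The module given by a vector space `W` and an algebra map from `D₄` to its endomorphisms. -/
noncomputable def ofAlgHom (W : Type u) [AddCommGroup W] [Module k W] [Module.Finite k W]
    (ρ : D4 k →ₐ[k] Module.End k W) : D4Mod k :=
  letI : Module (D4 k) W := Module.compHom W ρ.toRingHom
  { carrier := W
    isScalarTower := ⟨fun x h w => by
      change ρ (x • h) w = x • ρ h w
      simp⟩ }

/-- The tensor product over `k`, with `D₄` acting through its coproduct:
`h • (m ⊗ n) = ∑ h₁ m ⊗ h₂ n`. -/
noncomputable def tensor (M N : D4Mod k) : D4Mod k :=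
  ofAlgHom ((M : Type u) ⊗[k] (N : Type u))
    (((Module.endTensorEndAlgHom (R := k) (S := k) (A := k) (M := M) (N := N)).comp
      (Algebra.TensorProduct.map (Algebra.lsmul k k M) (Algebra.lsmul k k N))).comp
      (Bialgebra.comulAlgHom k (D4 k)))

/-- The direct sum of two modules. -/
noncomputable def sum (M N : D4Mod k) : D4Mod k where
  carrier := M × N

/-- The direct sum `nM` of `n` copies of `M`. -/
noncomputable def copies (n : ℕ) (M : D4Mod k) : D4Mod k where
  carrier := Fin n → M

/-- Two modules are isomorphic over `D₄`. -/
def Iso (M N : D4Mod k) : Prop := Nonempty (M ≃ₗ[D4 k] N)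

/-- The linear endomorphism of `ι → k` sending the standard basis vector `e_i` to `f i`. -/
noncomputable def basisEnd {ι : Type} [Finite ι] (f : ι → ι → k) : Module.End k (ι → k) :=
  (Pi.basisFun k ι).constr k f

/-- The module with basis `(e_i)` indexed by `ι` on which the generators act by
`x • e_i = f x i`. -/
noncomputable def ofBasis {ι : Type} [Finite ι] (f : D4.Gen → ι → ι → k)
    (h : D4.Relations fun x => basisEnd (f x)) : D4Mod k :=
  ofAlgHom (ι → k) (D4.lift _ h)

/-- The sign `(-1)^r`, `r ∈ ℤ/2`. -/
def sgn (k : Type u) [Field k] (r : ZMod 2) : k := (-1) ^ r.val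

/-- Standard basis vector. -/
def e {ι : Type} [DecidableEq ι] (i : ι) : ι → k := Pi.single i 1

/-- The action of the generators on the basis `v` of `V(r)`. -/
def actV (r : ZMod 2) : D4.Gen → Fin 1 → Fin 1 → k
  | .a, _ => 0
  | .b, i => sgn k r • e i
  | .c, i => sgn k r • e i
  | .d, _ => 0

/-- The action of the generators on the basis `v₁, v₂, v₃, v₄` (here `e 0, e 1, e 2, e 3`) of
`P(r)`. -/
def actP (r : ZMod 2) : D4.Gen → Fin 4 → Fin 4 → k
  | .a => ![e 1, 0, e 3, 0]
  | .b => ![sgn k r • e 0, sgn k (r + 1) • e 1, sgn k (r + 1) • e 2, sgn k r • e 3]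
  | .c => ![sgn k r • e 0, sgn k (r + 1) • e 1, sgn k (r + 1) • e 2, sgn k r • e 3]
  | .d => ![e 2, -e 3, 0, 0]

/-- For `i : Fin t`, the vector `w_i` of the basis `v_0, …, v_{t-1}, w_0, …, w_{t-1}`. -/
def w {t : ℕ} (i : Fin t) : Fin t ⊕ Fin t → k := e (Sum.inr i)

/-- For `i : Fin t`, the vector `w_{i-1}`, which is `0` if `i = 0`. -/
def wPred {t : ℕ} (i : Fin t) : Fin t ⊕ Fin t → k :=
  if i.val = 0 then 0 else w ⟨i.val - 1, by omega⟩

/-- The action of the generators on the basis `v_0, …, v_{t-1}, w_0, …, w_{t-1}` of `M_t(r, η)`.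
The points of the projective line are `k ∪ {∞}`. On the `w_i` both `a` and `d` vanish; for
`η ∈ k` one has `a v_i = w_i`, `d v_i = -η w_i - w_{i-1}`, and for `η = ∞` one has
`a v_i = w_{i-1}`, `d v_i = w_i` (with `w_{-1} = 0`); `b` and `c` act by `(-1)^{r+1}` on the `v_i`
and by `(-1)^r` on the `w_i`. -/
def actM (t : ℕ) (r : ZMod 2) (η : OnePoint k) : D4.Gen → Fin t ⊕ Fin t → Fin t ⊕ Fin t → k
  | .a, .inl i => η.elim (wPred i) fun _ => w i
  | .d, .inl i => η.elim (w i) fun x => -(x • w i) - wPred i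
  | .a, .inr _ => 0
  | .d, .inr _ => 0
  | .b, .inl i => sgn k (r + 1) • e (Sum.inl i)
  | .b, .inr i => sgn k r • e (Sum.inr i)
  | .c, .inl i => sgn k (r + 1) • e (Sum.inl i)
  | .c, .inr i => sgn k r • e (Sum.inr i)


theorem basisEnd_e {ι : Type} [Finite ι] [DecidableEq ι] (f : ι → ι → k) (i : ι) :
    basisEnd f (e i) = f i := by
  have := (Pi.basisFun k ι).constr_basis k f i
  rwa [Pi.basisFun_apply] at this

theorem sgn_mul_self (r : ZMod 2) : sgn k r * sgn k r = 1 := by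
  rw [sgn, ← mul_pow]; simp

theorem sgn_succ (r : ZMod 2) : sgn k (r + 1) = -sgn k r := by
  fin_cases r
  · change (-1 : k) ^ 1 = -(-1) ^ 0
    simp
  · change (-1 : k) ^ 0 = -(-1) ^ 1
    simp

theorem end_ext {ι : Type} [Finite ι] [DecidableEq ι] {f g : Module.End k (ι → k)}
    (h : ∀ i, f (e i) = g (e i)) : f = g := by
  apply (Pi.basisFun k ι).ext
  intro i
  rw [Pi.basisFun_apply]
  exact h i

theorem relations_V (r : ZMod 2) : D4.Relations fun x => basisEnd (actV (k := k) r x) := by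
  constructor <;> refine end_ext fun i => ?_ <;>
    simp [basisEnd_e, actV, smul_smul, sgn_mul_self]

theorem relations_P (r : ZMod 2) : D4.Relations fun x => basisEnd (actP (k := k) r x) := by
  constructor <;> refine end_ext fun i => ?_ <;> fin_cases i <;>
    simp [basisEnd_e, actP, smul_smul, sgn_mul_self, sgn_succ]

theorem basisEnd_wPred {t : ℕ} (r : ZMod 2) (η : OnePoint k) (i : Fin t) (x : D4.Gen) :
    basisEnd (actM t r η x) (wPred i) = match x with
      | .a => 0
      | .d => 0
      | .b => sgn k r • wPred i
      | .c => sgn k r • wPred i := by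
  unfold wPred
  split_ifs <;> cases x <;> simp [w, basisEnd_e, actM]

theorem relations_M (t : ℕ) (r : ZMod 2) (η : OnePoint k) :
    D4.Relations fun x => basisEnd (actM t r η x) := by
  constructor <;> refine end_ext fun i => ?_ <;> rcases i with i | i <;>
    induction η using OnePoint.rec <;>
    simp [basisEnd_e, actM, w, smul_smul, sgn_mul_self, sgn_succ, basisEnd_wPred] <;>
    module

/-- The one dimensional simple module `V(r)`. -/
noncomputable def V (k : Type u) [Field k] (r : ZMod 2) : D4Mod k := ofBasis (actV r) (relations_V r)

/-- The four dimensional projective module `P(r)`. -/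
noncomputable def P (k : Type u) [Field k] (r : ZMod 2) : D4Mod k := ofBasis (actP r) (relations_P r)

/-- The module `M_t(r, η)`, `η ∈ k ∪ {∞}`, for `t ≥ 1`: the iterated nonsplit extension of
`M_{t-1}(r, η)` by `M_1(r, η)`, which up to isomorphism is the unique indecomposable module of
Loewy length 2 with socle and top both of length `t` that contains `M_1(r, η)`.
The vectors `v_i, w_i` with `i < j` span the submodule `M_j(r, η)`. -/
noncomputable def M {k : Type u} [Field k] (t : ℕ) (r : ZMod 2) (η : OnePoint k) : D4Mod k :=
  ofBasis (actM t r η) (relations_M t r η)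

/-- `f : Q → M` is a projective cover: `Q` is projective, `f` is surjective and `ker f` is a
superfluous submodule of `Q`. -/
structure IsProjectiveCover {Q M : D4Mod k} (f : Q →ₗ[D4 k] M) : Prop where
  projective : Module.Projective (D4 k) Q
  surjective : Function.Surjective f
  superfluous : ∀ N : Submodule (D4 k) Q, N ⊔ LinearMap.ker f = ⊤ → N = ⊤

/-- Every finite dimensional module has a projective cover. -/
theorem exists_projectiveCover (M : D4Mod k) :
    ∃ (Q : D4Mod k) (f : Q →ₗ[D4 k] M), IsProjectiveCover f := by
  have hex : ∃ n : ℕ, ∃ (Q : D4Mod k) (f : Q →ₗ[D4 k] M), Module.Projective (D4 k) Q ∧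
      Function.Surjective f ∧ Module.finrank k Q = n := by
    have : Module.Finite (D4 k) M := Module.Finite.of_restrictScalars_finite k (D4 k) M
    obtain ⟨n, f, hf⟩ := Module.Finite.exists_fin' (D4 k) M
    exact ⟨_, ⟨Fin n → D4 k⟩, f, inferInstanceAs (Module.Projective (D4 k) (Fin n → D4 k)), hf, rfl⟩
  classical
  obtain ⟨Q, f, hQ, hf, hn⟩ := Nat.find_spec hex
  refine ⟨Q, f, hQ, hf, fun N hN => ?_⟩
  have hsurj : Function.Surjective (f ∘ₗ N.subtype) := by
    intro m
    obtain ⟨q, rfl⟩ := hf m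
    have hq : q ∈ N ⊔ LinearMap.ker f := by rw [hN]; trivial
    obtain ⟨y, hy, z, hz, rfl⟩ := Submodule.mem_sup.mp hq
    exact ⟨⟨y, hy⟩, by simpa using hz⟩
  obtain ⟨g, hg⟩ := Module.projective_lifting_property (f ∘ₗ N.subtype) f hsurj
  set G : Q →ₗ[D4 k] Q := N.subtype ∘ₗ g with hG
  have hfG : ∀ q, f (G q) = f q := fun q => LinearMap.congr_fun hg q
  have hfGn : ∀ (n : ℕ) (q : Q), f ((G ^ n) q) = f q := by
    intro n
    induction n with
    | zero => simp
    | succ n ih => intro q; rw [pow_succ, Module.End.mul_apply, ih, hfG]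
  have : IsNoetherian (D4 k) Q := isNoetherian_of_tower k inferInstance
  have : IsArtinian (D4 k) Q := isArtinian_of_tower k inferInstance
  obtain ⟨n, hcompl, hn1⟩ := ((LinearMap.eventually_isCompl_ker_pow_range_pow G).and
    (Filter.eventually_ge_atTop 1)).exists
  let R : Submodule (D4 k) Q := LinearMap.range (G ^ n)
  have hRproj : Module.Projective (D4 k) R :=
    Module.Projective.of_split R.subtype
      (Submodule.projectionOnto R _ hcompl.symm) (by ext x; simp)
  have hRfin : Module.Finite k R :=
    Module.Finite.of_injective (R.subtype.restrictScalars k) R.injective_subtype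
  have hmin := Nat.find_min' hex ⟨⟨R⟩, f ∘ₗ R.subtype, hRproj, fun m => by
    obtain ⟨q, rfl⟩ := hf m
    exact ⟨⟨(G ^ n) q, q, rfl⟩, hfGn n q⟩, rfl⟩
  rw [← hn] at hmin
  have hRtop : R.restrictScalars k = ⊤ :=
    Submodule.eq_top_of_finrank_eq (le_antisymm (Submodule.finrank_le _) hmin)
  rw [eq_top_iff]
  rintro q -
  have hq : q ∈ R.restrictScalars k := by rw [hRtop]; trivial
  obtain ⟨p, rfl⟩ := hq
  obtain ⟨m, rfl⟩ : ∃ m, n = m + 1 := ⟨n - 1, by omega⟩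
  rw [pow_succ', Module.End.mul_apply]
  exact (g _).2

/-- The projective cover `P(M)` of `M`. -/
noncomputable def cover (M : D4Mod k) : D4Mod k := (exists_projectiveCover M).choose

/-- The map `P(M) → M`. -/
noncomputable def coverMap (M : D4Mod k) : cover M →ₗ[D4 k] M :=
  (exists_projectiveCover M).choose_spec.choose

theorem coverMap_isProjectiveCover (M : D4Mod k) : IsProjectiveCover (coverMap M) :=
  (exists_projectiveCover M).choose_spec.choose_spec

/-- The syzygy `Ω M`, the kernel of the projective cover `P(M) → M`. -/
noncomputable def syzygy (M : D4Mod k) : D4Mod k :=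
  { carrier := LinearMap.ker (coverMap M)
    finiteDimensional := Module.Finite.of_injective
      ((LinearMap.ker (coverMap M)).subtype.restrictScalars k) (Submodule.injective_subtype _) }

/-- The iterated syzygy `Ω^s M`; in particular `Ω^0 M = M`. -/
noncomputable def Omega : ℕ → D4Mod k → D4Mod k
  | 0, M => M
  | s + 1, M => syzygy (Omega s M)

end Constructions

end D4Mod

/-! On a vector where `b` and `c` act by the same sign, `bc` acts as the identity, so `a` and `d`
anticommute there and combinations of them multiply as in an exterior algebra on two generators.
Hence any basis α, β of the span of `a` and `d` serves as well as `a, d` itself. `pencil` picks the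
basis adapted to η, the one with α v_i = w_i and β v_i = w_{i-1} in M_t(r, η); from then on η plays
no role.

In every such basis Ω^s V(r') is a zigzag: it is generated by x_0, …, x_s with β x_0 = 0, β x_{j+1}
= α x_j and α x_s = 0, has dimension 2s + 1, and `b`, `c` act on the x_j by (-1)^{r'+s}. This goes
by induction on s (`IsZigzag.ker_cover`): if y_j lifts x_j to the projective cover, then β y_0 and
the differences β y_{j+1} - α y_j form a zigzag, one step longer, that generates the kernel.

In the tensor product put u_{i,j} = ∑_{l ≤ i} v_{i-l} ⊗ x_{j+l}. For j = 0 a telescoping sum gives β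
u_{0,0} = 0 and β u_{i+1,0} = α u_{i,0} (`beta_antidiag`), so these vectors define a map from
M_t(r+r'+s, η). For 1 ≤ j ≤ s each u_{i,j} is merely an eigenvector and defines a map from
P(r+r'+s+1). All the u_{i,j} together generate the tensor product (`eq_top_of_antidiag_mem`), and
4st + 2t = 2t(2s + 1), so the sum of these maps is an isomorphism. The parity of s decides the
signs. -/

namespace D4

/-! ### Combinations of `a` and `d`, and the relations acting on vectors -/

/-- The element `p a + q d` of `D₄`. -/
noncomputable def lin {k : Type u} [Field k] (α : k × k) : D4 k :=
  α.1 • gen k .a + α.2 • gen k .d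

/-- The determinant of a pair of vectors of `k²`. -/
def det {k : Type u} [Field k] (α β : k × k) : k := α.1 * β.2 - α.2 * β.1

section Relations

variable {k : Type u} [Field k] {N : Type*} [AddCommGroup N] [Module (D4 k) N]

theorem b_a_smul (n : N) : gen k .b • gen k .a • n = -(gen k .a • gen k .b • n) := by
  simp only [← mul_smul, (gen_relations k).ba, neg_smul]

theorem c_a_smul (n : N) : gen k .c • gen k .a • n = -(gen k .a • gen k .c • n) := by
  simp only [← mul_smul, (gen_relations k).ca, neg_smul]

theorem b_d_smul (n : N) : gen k .b • gen k .d • n = -(gen k .d • gen k .b • n) := by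
  simp only [← mul_smul, (gen_relations k).db, neg_smul, neg_neg]

theorem c_d_smul (n : N) : gen k .c • gen k .d • n = -(gen k .d • gen k .c • n) := by
  simp only [← mul_smul, (gen_relations k).dc, neg_smul, neg_neg]

@[simp] theorem a_a_smul (n : N) : gen k .a • gen k .a • n = 0 := by
  simp only [← mul_smul, (gen_relations k).aa, zero_smul]

@[simp] theorem d_d_smul (n : N) : gen k .d • gen k .d • n = 0 := by
  simp only [← mul_smul, (gen_relations k).dd, zero_smul]

@[simp] theorem b_b_smul (n : N) : gen k .b • gen k .b • n = n := by
  simp only [← mul_smul, (gen_relations k).bb, one_smul]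

@[simp] theorem c_c_smul (n : N) : gen k .c • gen k .c • n = n := by
  simp only [← mul_smul, (gen_relations k).cc, one_smul]

theorem c_b_smul (n : N) : gen k .c • gen k .b • n = gen k .b • gen k .c • n := by
  simp only [← mul_smul, (gen_relations k).bc]

end Relations

/-! ### Joint eigenvectors of `b` and `c` -/

section Action

variable {k : Type u} [Field k] {N : Type*} [AddCommGroup N] [Module k N] [Module (D4 k) N]

/-- Both `b` and `c` act on `n` by the scalar `σ`. -/
def IsEigen (σ : k) (n : N) : Prop :=
  gen k .b • n = σ • n ∧ gen k .c • n = σ • n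

theorem IsEigen.zero (σ : k) : IsEigen σ (0 : N) := by simp [IsEigen]

theorem IsEigen.add {σ : k} {m n : N} (hm : IsEigen σ m) (hn : IsEigen σ n) :
    IsEigen σ (m + n) := by
  simp [IsEigen, hm.1, hm.2, hn.1, hn.2]

theorem IsEigen.sub {σ : k} {m n : N} (hm : IsEigen σ m) (hn : IsEigen σ n) :
    IsEigen σ (m - n) := by
  simp [IsEigen, hm.1, hm.2, hn.1, hn.2, smul_sub]

theorem IsEigen.map {N' : Type*} [AddCommGroup N'] [Module k N'] [Module (D4 k) N']
    [IsScalarTower k (D4 k) N] [IsScalarTower k (D4 k) N']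
    {σ : k} {n : N} (hn : IsEigen σ n) (f : N →ₗ[D4 k] N') : IsEigen σ (f n) := by
  have h (x : k) (n : N) : f (x • n) = x • f n := (f.restrictScalars k).map_smul x n
  exact ⟨by rw [← map_smul, hn.1, h], by rw [← map_smul, hn.2, h]⟩

variable [IsScalarTower k (D4 k) N]

theorem gen_smul_smul (x : Gen) (r : k) (n : N) : gen k x • r • n = r • gen k x • n :=
  smul_comm _ _ _

theorem lin_smul (α : k × k) (n : N) :
    lin α • n = α.1 • gen k .a • n + α.2 • gen k .d • n := by
  simp [lin, add_smul]

/-- Here `bc` acts by σ² = 1, so the right-hand side of da + ad = 1 - bc vanishes. This is the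
source of the exterior algebra calculus in the lemmas on `lin`. -/
theorem IsEigen.d_a_smul {σ : k} (hσ : σ * σ = 1) {n : N} (hn : IsEigen σ n) :
    gen k .d • gen k .a • n = -(gen k .a • gen k .d • n) := by
  rw [eq_neg_iff_add_eq_zero, ← mul_smul, ← mul_smul, ← add_smul, (gen_relations k).da, sub_smul,
    mul_smul, hn.2, smul_comm, hn.1, smul_smul, hσ, one_smul, one_smul, sub_self]

theorem IsEigen.a_smul {σ : k} {n : N} (hn : IsEigen σ n) : IsEigen (-σ) (gen k .a • n) := by
  constructor
  · rw [b_a_smul, hn.1, smul_comm, neg_smul]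
  · rw [c_a_smul, hn.2, smul_comm, neg_smul]

theorem IsEigen.d_smul {σ : k} {n : N} (hn : IsEigen σ n) : IsEigen (-σ) (gen k .d • n) := by
  constructor
  · rw [b_d_smul, hn.1, smul_comm, neg_smul]
  · rw [c_d_smul, hn.2, smul_comm, neg_smul]

theorem IsEigen.smul {σ : k} {n : N} (hn : IsEigen σ n) (x : k) : IsEigen σ (x • n) := by
  constructor
  · rw [smul_comm, hn.1, smul_comm]
  · rw [smul_comm, hn.2, smul_comm]

theorem IsEigen.lin_smul {σ : k} {n : N} (hn : IsEigen σ n) (α : k × k) :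
    IsEigen (-σ) (lin α • n) := by
  rw [D4.lin_smul]
  exact (hn.a_smul.smul _).add (hn.d_smul.smul _)

theorem IsEigen.lin_lin_smul {σ : k} (hσ : σ * σ = 1) {n : N} (hn : IsEigen σ n) (α β : k × k) :
    lin α • lin β • n = det α β • gen k .a • gen k .d • n := by
  simp only [D4.lin_smul, smul_add, gen_smul_smul, a_a_smul, d_d_smul, hn.d_a_smul hσ, det]
  generalize gen k .a • gen k .d • n = u
  module

theorem IsEigen.lin_lin_self {σ : k} (hσ : σ * σ = 1) {n : N} (hn : IsEigen σ n) (α : k × k) :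
    lin α • lin α • n = 0 := by
  rw [hn.lin_lin_smul hσ, det, mul_comm, sub_self, zero_smul]

theorem IsEigen.lin_lin_comm {σ : k} (hσ : σ * σ = 1) {n : N} (hn : IsEigen σ n) (α β : k × k) :
    lin β • lin α • n = -(lin α • lin β • n) := by
  rw [hn.lin_lin_smul hσ, hn.lin_lin_smul hσ, ← neg_smul]
  congr 1
  simp only [det]
  ring

/-- Cramer's rule: with determinant -1 the pair α, β is inverted without division, so stability
under α and β can be traded for stability under `a` and `d`. -/
theorem a_smul_eq {α β : k × k} (h : det α β = -1) (n : N) :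
    gen k .a • n = α.2 • lin β • n - β.2 • lin α • n := by
  have h' : α.2 * β.1 = 1 + α.1 * β.2 := by
    rw [det] at h
    linear_combination -h
  simp only [lin_smul, smul_add, smul_smul, h', mul_comm β.2]
  generalize gen k .a • n = u
  generalize gen k .d • n = u'
  module

theorem d_smul_eq {α β : k × k} (h : det α β = -1) (n : N) :
    gen k .d • n = β.1 • lin α • n - α.1 • lin β • n := by
  have h' : β.1 * α.2 = 1 + α.1 * β.2 := by
    rw [det] at h
    linear_combination -h
  simp only [lin_smul, smul_add, smul_smul, h', mul_comm β.1 α.1]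
  generalize gen k .a • n = u
  generalize gen k .d • n = u'
  module

theorem exists_proj_eq (h : D4 k) : ∃ z, proj k z = h :=
  RingQuot.mkAlgHom_surjective k (Rel k) h

/-- A `k`-linear map that commutes with the generators is `D₄`-linear. -/
noncomputable def linearMapOfGen {N' : Type*} [AddCommGroup N'] [Module k N'] [Module (D4 k) N']
    [IsScalarTower k (D4 k) N'] (f : N →ₗ[k] N')
    (hf : ∀ x n, f (gen k x • n) = gen k x • f n) : N →ₗ[D4 k] N' where
  toFun := f
  map_add' := f.map_add
  map_smul' := by
    intro h
    obtain ⟨z, rfl⟩ := exists_proj_eq h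
    simp only [RingHom.id_apply]
    induction z using FreeAlgebra.induction with
    | grade0 r => intro n; simp [algebraMap_smul]
    | grade1 x => exact hf x
    | mul y z hy hz => intro n; rw [map_mul, mul_smul, hy, hz, mul_smul]
    | add y z hy hz => intro n; rw [map_add, add_smul, map_add, hy, hz, add_smul]

@[simp] theorem linearMapOfGen_apply {N' : Type*} [AddCommGroup N'] [Module k N']
    [Module (D4 k) N'] [IsScalarTower k (D4 k) N'] (f : N →ₗ[k] N')
    (hf : ∀ x n, f (gen k x • n) = gen k x • f n) (n : N) : linearMapOfGen f hf n = f n := rfl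

/-- A `k`-linear map that commutes with the generators on a basis is `D₄`-linear. -/
theorem map_gen_smul_of_basis {N' : Type*} [AddCommGroup N'] [Module k N'] [Module (D4 k) N']
    [IsScalarTower k (D4 k) N'] {ι : Type*} [Finite ι] (B : Module.Basis ι k N) (f : N →ₗ[k] N')
    (hf : ∀ x i, f (gen k x • B i) = gen k x • f (B i)) (x : Gen) (n : N) :
    f (gen k x • n) = gen k x • f n := by
  have := Fintype.ofFinite ι
  rw [← B.sum_repr n]
  simp only [Finset.smul_sum, map_sum]
  refine Finset.sum_congr rfl fun i _ => ?_
  rw [gen_smul_smul, f.map_smul, f.map_smul, gen_smul_smul, hf]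

/-- In characteristic different from two, an eigenvector lifts to an eigenvector. -/
theorem exists_isEigen_lift (h2 : (2 : k) ≠ 0) {N' : Type*} [AddCommGroup N'] [Module k N']
    [Module (D4 k) N'] [IsScalarTower k (D4 k) N'] {f : N →ₗ[D4 k] N'}
    (hf : Function.Surjective f) {σ : k} (hσ : σ * σ = 1) {x : N'} (hx : IsEigen σ x) :
    ∃ y, IsEigen σ y ∧ f y = x := by
  obtain ⟨y, rfl⟩ := hf x
  have hs (x : k) (n : N) : f (x • n) = x • f n := (f.restrictScalars k).map_smul x n
  -- Since σ² = 1, this is (1 + σb)(1 + σc) y, four times the projection of y to the joint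
  -- eigenspace.
  have hw : IsEigen σ
      (y + σ • gen k .b • y + σ • gen k .c • y + gen k .b • gen k .c • y) := by
    constructor
    · simp only [smul_add, gen_smul_smul, b_b_smul, smul_smul σ σ, hσ, one_smul]
      abel
    · simp only [smul_add, gen_smul_smul, c_c_smul, smul_smul σ σ, hσ, one_smul, c_b_smul]
      abel
  refine ⟨((2 : k)⁻¹ * 2⁻¹) • _, hw.smul _, ?_⟩
  simp only [hs, map_add, map_smul, hx.1, hx.2, gen_smul_smul, smul_smul σ σ, hσ, one_smul]
  generalize f y = z
  have h4 : z + z + z + z = ((2 : k) * 2) • z := by module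
  rw [h4, smul_smul]
  field_simp
  rw [one_smul]

end Action

end D4

/-! ### The modules P(r) and the maps out of them -/

namespace D4Mod

open D4

section Modules

variable {k : Type u} [Field k]

/-- The basis of a module defined by the action of the generators on a basis. -/
noncomputable def stdBasis {ι : Type} [Finite ι] (f : D4.Gen → ι → ι → k)
    (h : D4.Relations fun x => basisEnd (f x)) : Module.Basis ι k (ofBasis f h) :=
  Pi.basisFun k ι

theorem stdBasis_apply {ι : Type} [Finite ι] [DecidableEq ι] (f : D4.Gen → ι → ι → k)
    (h : D4.Relations fun x => basisEnd (f x)) (i : ι) :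
    stdBasis f h i = (e i : ι → k) :=
  Pi.basisFun_apply k ι i

theorem gen_smul_stdBasis {ι : Type} [Finite ι] (f : D4.Gen → ι → ι → k)
    (h : D4.Relations fun x => basisEnd (f x)) (x : Gen) (i : ι) :
    gen k x • stdBasis f h i = (f x i : ι → k) := by
  classical
  rw [stdBasis_apply]
  change (D4.lift _ h (gen k x)) (e i) = _
  rw [lift_gen, basisEnd_e]

/-- The basis `v₁, v₂, v₃, v₄` of `P(r)`. -/
noncomputable def basisP (k : Type u) [Field k] (r : ZMod 2) : Module.Basis (Fin 4) k (P k r) :=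
  stdBasis (actP r) (relations_P r)

theorem basisP_apply (r : ZMod 2) (i : Fin 4) : basisP k r i = (e i : Fin 4 → k) :=
  stdBasis_apply _ _ i

theorem gen_smul_basisP (r : ZMod 2) (x : Gen) (i : Fin 4) :
    gen k x • basisP k r i = (actP r x i : Fin 4 → k) :=
  gen_smul_stdBasis _ _ x i

variable (r : ZMod 2)

@[simp] theorem a_smul_basisP_zero : gen k .a • basisP k r 0 = basisP k r 1 := by
  rw [gen_smul_basisP, basisP_apply]; rfl

@[simp] theorem a_smul_basisP_one : gen k .a • basisP k r 1 = 0 := by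
  rw [gen_smul_basisP]; rfl

@[simp] theorem a_smul_basisP_two : gen k .a • basisP k r 2 = basisP k r 3 := by
  rw [gen_smul_basisP, basisP_apply]; rfl

@[simp] theorem a_smul_basisP_three : gen k .a • basisP k r 3 = 0 := by
  rw [gen_smul_basisP]; rfl

@[simp] theorem d_smul_basisP_zero : gen k .d • basisP k r 0 = basisP k r 2 := by
  rw [gen_smul_basisP, basisP_apply]; rfl

@[simp] theorem d_smul_basisP_one : gen k .d • basisP k r 1 = -basisP k r 3 := by
  rw [gen_smul_basisP, basisP_apply]; rfl

@[simp] theorem d_smul_basisP_two : gen k .d • basisP k r 2 = 0 := by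
  rw [gen_smul_basisP]; rfl

@[simp] theorem d_smul_basisP_three : gen k .d • basisP k r 3 = 0 := by
  rw [gen_smul_basisP]; rfl

theorem isEigen_basisP_zero : IsEigen (sgn k r) (basisP k r 0) := by
  constructor <;> rw [gen_smul_basisP, basisP_apply] <;> rfl

theorem isEigen_basisP_one : IsEigen (-sgn k r) (basisP k r 1) := by
  rw [← a_smul_basisP_zero]; exact (isEigen_basisP_zero r).a_smul

theorem isEigen_basisP_two : IsEigen (-sgn k r) (basisP k r 2) := by
  rw [← d_smul_basisP_zero]; exact (isEigen_basisP_zero r).d_smul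

theorem isEigen_basisP_three : IsEigen (sgn k r) (basisP k r 3) := by
  rw [← a_smul_basisP_two, ← neg_neg (sgn k r)]; exact (isEigen_basisP_two r).a_smul

theorem exists_eq_basisP (p : P k r) : ∃ x₀ x₁ x₂ x₃ : k,
    p = x₀ • basisP k r 0 + x₁ • basisP k r 1 + x₂ • basisP k r 2 + x₃ • basisP k r 3 :=
  ⟨_, _, _, _, by
    conv_lhs => rw [← (basisP k r).sum_repr p]
    rw [Fin.sum_univ_four]⟩

section Hom

variable {N : Type*} [AddCommGroup N] [Module k N] [Module (D4 k) N] [IsScalarTower k (D4 k) N]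

/-- The map `P(r) → N` that sends `v₁` to a given eigenvector `z`. -/
noncomputable def homP {z : N} (hz : IsEigen (sgn k r) z) : P k r →ₗ[D4 k] N :=
  linearMapOfGen ((basisP k r).constr k
      ![z, gen k .a • z, gen k .d • z, gen k .a • gen k .d • z])
    (map_gen_smul_of_basis (basisP k r) _ (by
      intro x i
      have h := hz.d_a_smul (sgn_mul_self r)
      have ha := hz.a_smul
      have hd := hz.d_smul
      have had := hd.a_smul
      rw [neg_neg] at had
      have h0 := isEigen_basisP_zero (k := k) r
      have h1 := isEigen_basisP_one (k := k) r
      have h2 := isEigen_basisP_two (k := k) r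
      have h3 := isEigen_basisP_three (k := k) r
      have h4 : gen k .d • gen k .a • gen k .d • z = 0 := by
        rw [hd.d_a_smul (by rw [neg_mul_neg, sgn_mul_self]), d_d_smul, smul_zero, neg_zero]
      have hg := (basisP k r).constr_basis k
        ![z, gen k .a • z, gen k .d • z, gen k .a • gen k .d • z]
      generalize (basisP k r).constr k
        ![z, gen k .a • z, gen k .d • z, gen k .a • gen k .d • z] = g at hg ⊢
      rw [hg]
      fin_cases i <;> cases x <;>
        simp [hg, h, h4, h0.1, h0.2, h1.1, h1.2, h2.1, h2.2, h3.1, h3.2, hz.1, hz.2, ha.1, ha.2,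
          hd.1, hd.2, had.1, had.2]))

@[simp] theorem homP_basisP {z : N} (hz : IsEigen (sgn k r) z) (i : Fin 4) :
    homP r hz (basisP k r i) = ![z, gen k .a • z, gen k .d • z, gen k .a • gen k .d • z] i := by
  rw [homP, linearMapOfGen_apply, Module.Basis.constr_basis]

theorem homP_smul {z : N} (hz : IsEigen (sgn k r) z) (x : k) (p : P k r) :
    homP r hz (x • p) = x • homP r hz p :=
  ((homP r hz).restrictScalars k).map_smul x p

/-- The map `n P(r) → N` that sends the generators to given eigenvectors `z`. -/
noncomputable def homCopiesP {n : ℕ} {z : Fin n → N} (hz : ∀ j, IsEigen (sgn k r) (z j)) :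
    (Fin n → P k r) →ₗ[D4 k] N :=
  ∑ j, (homP r (hz j)) ∘ₗ LinearMap.proj j

theorem homCopiesP_apply {n : ℕ} {z : Fin n → N} (hz : ∀ j, IsEigen (sgn k r) (z j))
    (p : Fin n → P k r) : homCopiesP r hz p = ∑ j, homP r (hz j) (p j) := by
  simp [homCopiesP]

@[simp] theorem homCopiesP_single {n : ℕ} {z : Fin n → N} (hz : ∀ j, IsEigen (sgn k r) (z j))
    (j : Fin n) (p : P k r) : homCopiesP r hz (Pi.single j p) = homP r (hz j) p := by
  rw [homCopiesP_apply, Finset.sum_eq_single j]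
  · simp
  · intro i _ hi
    simp [hi]
  · simp

/-- A `k`-subspace containing `z, αz, βz, αβz` for an eigenvector `z` contains `D₄ z`. -/
theorem smul_mem_of_isEigen {z : N} (hz : IsEigen (sgn k r) z) {α β : k × k} (hdet : det α β = -1)
    {U : Submodule k N} (h : z ∈ U) (hα : lin α • z ∈ U) (hβ : lin β • z ∈ U)
    (hαβ : lin α • lin β • z ∈ U) (y : D4 k) : y • z ∈ U := by
  have ha : gen k .a • z ∈ U := by
    rw [a_smul_eq hdet]
    exact U.sub_mem (U.smul_mem _ hβ) (U.smul_mem _ hα)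
  have hd : gen k .d • z ∈ U := by
    rw [d_smul_eq hdet]
    exact U.sub_mem (U.smul_mem _ hα) (U.smul_mem _ hβ)
  have had : gen k .a • gen k .d • z ∈ U := by
    rw [hz.lin_lin_smul (sgn_mul_self r), hdet, neg_smul, one_smul] at hαβ
    exact neg_mem_iff.mp hαβ
  -- D₄ z is the image of P(r) under v₁ ↦ z, hence spanned by z, az, dz and adz.
  obtain ⟨x₀, x₁, x₂, x₃, hx⟩ := exists_eq_basisP r (y • basisP k r 0)
  have := congrArg (homP r hz) hx
  simp only [map_smul, map_add, homP_smul, homP_basisP] at this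
  change y • z = x₀ • z + x₁ • gen k .a • z + x₂ • gen k .d • z + x₃ • gen k .a • gen k .d • z
    at this
  rw [this]
  exact U.add_mem (U.add_mem (U.add_mem (U.smul_mem _ h) (U.smul_mem _ ha)) (U.smul_mem _ hd))
    (U.smul_mem _ had)

end Hom

/-- The vectors v₂ and v₃ carry the opposite sign, which differs from (-1)^r because 2 ≠ 0. -/
theorem eq_of_isEigen_P (h2 : (2 : k) ≠ 0) {p : P k r} (hp : IsEigen (sgn k r) p) :
    ∃ x y : k, p = x • basisP k r 0 + y • basisP k r 3 := by
  obtain ⟨x₀, x₁, x₂, x₃, rfl⟩ := exists_eq_basisP r p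
  refine ⟨x₀, x₃, ?_⟩
  have h := hp.1
  have hs : sgn k r ≠ 0 := fun h => by simpa [h] using sgn_mul_self (k := k) r
  simp only [smul_add, gen_smul_smul, (isEigen_basisP_zero r).1, (isEigen_basisP_one r).1,
    (isEigen_basisP_two r).1, (isEigen_basisP_three r).1] at h
  have h' : (2 : k) • sgn k r • (x₁ • basisP k r 1 + x₂ • basisP k r 2) = 0 := by
    rw [← sub_eq_zero] at h
    rw [← neg_eq_zero, ← h]
    module
  have h'' := (smul_eq_zero.mp ((smul_eq_zero.mp h').resolve_left h2)).resolve_left hs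
  rw [add_assoc (x₀ • _), h'', add_zero]

theorem finrank_P : Module.finrank k (P k r) = 4 := by
  rw [Module.finrank_eq_card_basis (basisP k r), Fintype.card_fin]

end Modules

end D4Mod

/-! ### Zigzag modules and the syzygies of V(r) -/

namespace D4Mod

open D4

/-- The vectors `x 0, …, x s` are the top of a zigzag `β x (j + 1) = α x j` that generates `N`,
where `b` and `c` act on the top by `(-1)^r`. -/
structure IsZigzag {k : Type u} [Field k] {N : Type*} [AddCommGroup N] [Module k N]
    [Module (D4 k) N] (α β : k × k) (r : ZMod 2) (s : ℕ) (x : ℕ → N) : Prop where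
  isEigen : ∀ j, IsEigen (sgn k r) (x j)
  -- Extension by zero turns `beta_succ` at j = s into the end condition α x_s = 0.
  eq_zero : ∀ j, s < j → x j = 0
  beta_zero : lin β • x 0 = 0
  beta_succ : ∀ j, lin β • x (j + 1) = lin α • x j
  span_eq_top : Submodule.span (D4 k) (Set.range x) = ⊤
  -- The vectors x_0, …, x_s and α x_0, …, α x_{s-1} span N over k; the dimension forces them to be
  -- a basis.
  finrank_eq : Module.finrank k N = 2 * s + 1

namespace IsZigzag

variable {k : Type u} [Field k] {α β : k × k} {r : ZMod 2} {s : ℕ}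

section

variable {N : Type*} [AddCommGroup N] [Module k N] [Module (D4 k) N]
  {x : ℕ → N}

theorem alpha_eq_zero (hx : IsZigzag α β r s x) {j : ℕ} (hj : s ≤ j) : lin α • x j = 0 := by
  rw [← hx.beta_succ, hx.eq_zero _ (by omega), smul_zero]

variable [IsScalarTower k (D4 k) N]

theorem alpha_beta (hx : IsZigzag α β r s x) (j : ℕ) : lin α • lin β • x j = 0 := by
  cases j with
  | zero => rw [hx.beta_zero, smul_zero]
  | succ j => rw [hx.beta_succ, (hx.isEigen j).lin_lin_self (sgn_mul_self r)]

theorem a_d (hx : IsZigzag α β r s x) (hdet : det α β = -1) (j : ℕ) :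
    gen k .a • gen k .d • x j = 0 := by
  have := hx.alpha_beta j
  rwa [(hx.isEigen j).lin_lin_smul (sgn_mul_self r), hdet, neg_smul, one_smul, neg_eq_zero] at this

theorem eq_top (hx : IsZigzag α β r s x) (hdet : det α β = -1) {U : Submodule k N}
    (h : ∀ j, x j ∈ U) (hα : ∀ j, lin α • x j ∈ U) : U = ⊤ := by
  rw [eq_top_iff]
  rintro n -
  have hn : n ∈ Submodule.span (D4 k) (Set.range x) := by rw [hx.span_eq_top]; trivial
  induction hn using Submodule.closure_induction with
  | zero => exact U.zero_mem
  | add m n _ _ hm hn => exact U.add_mem hm hn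
  | smul_mem y n hn =>
    obtain ⟨j, rfl⟩ := hn
    refine smul_mem_of_isEigen r (hx.isEigen j) hdet (h j) (hα j) ?_ ?_ y
    · cases j with
      | zero => rw [hx.beta_zero]; exact U.zero_mem
      | succ j => rw [hx.beta_succ]; exact hα j
    · rw [hx.alpha_beta]; exact U.zero_mem

theorem span_family (hx : IsZigzag α β r s x) (hdet : det α β = -1) :
    Submodule.span k (Set.range (Sum.elim (fun j : Fin (s + 1) => x j)
      fun j : Fin s => lin α • x j)) = ⊤ := by
  refine hx.eq_top hdet (fun j => ?_) fun j => ?_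
  · by_cases hj : j < s + 1
    · exact Submodule.subset_span ⟨Sum.inl ⟨j, hj⟩, rfl⟩
    · rw [hx.eq_zero j (by omega)]
      exact Submodule.zero_mem _
  · by_cases hj : j < s
    · exact Submodule.subset_span ⟨Sum.inr ⟨j, hj⟩, rfl⟩
    · rw [hx.alpha_eq_zero (by omega)]
      exact Submodule.zero_mem _

theorem linearIndependent_family (hx : IsZigzag α β r s x) (hdet : det α β = -1) :
    LinearIndependent k (Sum.elim (fun j : Fin (s + 1) => x j)
      fun j : Fin s => lin α • x j) := by
  refine linearIndependent_of_top_le_span_of_card_eq_finrank (hx.span_family hdet).ge ?_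
  rw [hx.finrank_eq, Fintype.card_sum, Fintype.card_fin, Fintype.card_fin]
  omega

theorem linearIndependent (hx : IsZigzag α β r s x) (hdet : det α β = -1) :
    LinearIndependent k (fun j : Fin (s + 1) => x j) :=
  (hx.linearIndependent_family hdet).comp Sum.inl Sum.inl_injective

end

/-- Any `D₄`-submodule of `n P(r)` containing the generators is everything. -/
theorem eq_top_of_single_mem {n : ℕ} {R : Submodule (D4 k) (Fin n → P k r)}
    (h : ∀ i, Pi.single i (basisP k r 0) ∈ R) : R = ⊤ := by
  have ha (i : Fin n) (l : Fin 4) : gen k .a • (Pi.single i (basisP k r l) : Fin n → P k r) =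
      Pi.single i (gen k .a • basisP k r l) := (Pi.single_smul i _ _).symm
  have hd (i : Fin n) (l : Fin 4) : gen k .d • (Pi.single i (basisP k r l) : Fin n → P k r) =
      Pi.single i (gen k .d • basisP k r l) := (Pi.single_smul i _ _).symm
  have h1 (i) : Pi.single i (basisP k r 1) ∈ R := by
    simpa [ha] using R.smul_mem (gen k .a) (h i)
  have h2 (i) : Pi.single i (basisP k r 2) ∈ R := by
    simpa [hd] using R.smul_mem (gen k .d) (h i)
  have h3 (i) : Pi.single i (basisP k r 3) ∈ R := by
    simpa [ha] using R.smul_mem (gen k .a) (h2 i)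
  rw [eq_top_iff]
  rintro p -
  rw [← Finset.univ_sum_single p]
  refine R.sum_mem fun i _ => ?_
  obtain ⟨x₀, x₁, x₂, x₃, hp⟩ := exists_eq_basisP r (p i)
  have key (y : k) (q : P k r) (hq : (Pi.single i q : Fin n → P k r) ∈ R) :
      (Pi.single i (y • q) : Fin n → P k r) ∈ R := by
    rw [Pi.single_smul]
    exact (R.restrictScalars k).smul_mem y hq
  rw [hp, Pi.single_add, Pi.single_add, Pi.single_add]
  exact R.add_mem (R.add_mem (R.add_mem (key _ _ (h i)) (key _ _ (h1 i))) (key _ _ (h2 i)))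
    (key _ _ (h3 i))

section Cover

variable {Q N : D4Mod k} {f : Q →ₗ[D4 k] N} {x : ℕ → N} {y : ℕ → Q}

theorem eq_top_of_mem (hx : IsZigzag α β r s x) (hf : IsProjectiveCover f)
    (hfy : ∀ j, f (y j) = x j) {R : Submodule (D4 k) Q} (h : ∀ j, y j ∈ R) : R = ⊤ := by
  refine hf.superfluous R ?_
  have hR : R.map f = ⊤ := by
    rw [eq_top_iff, ← hx.span_eq_top, Submodule.span_le]
    rintro _ ⟨j, rfl⟩
    exact ⟨y j, h j, hfy j⟩
  rw [← Submodule.comap_map_eq, hR, Submodule.comap_top]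

/-- Q is compared with F = (s+1) P(r) by surjections both ways. The map F → Q onto the lifts y_j is
surjective because the kernel of f is superfluous. Conversely, projectivity of Q lifts f through F →
N to some ψ. Since the x_j are independent and `ad` kills them, ψ(y_j) is the j-th generator up to
multiples of the vectors v₄, so ψ is surjective. -/
theorem finrank_cover (h2 : (2 : k) ≠ 0) (hx : IsZigzag α β r s x) (hdet : det α β = -1)
    (hf : IsProjectiveCover f) (hy : ∀ j, IsEigen (sgn k r) (y j)) (hy0 : ∀ j, s < j → y j = 0)
    (hfy : ∀ j, f (y j) = x j) : Module.finrank k Q = 4 * (s + 1) := by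
  have hF : Module.finrank k (Fin (s + 1) → P k r) = 4 * (s + 1) := by
    rw [Module.finrank_pi_fintype]
    simp [finrank_P, mul_comm]
  refine le_antisymm ?_ ?_
  · have hsurj : LinearMap.range (homCopiesP r fun j : Fin (s + 1) => hy j) = ⊤ := by
      refine hx.eq_top_of_mem hf hfy fun j => ?_
      by_cases hj : j < s + 1
      · exact ⟨Pi.single ⟨j, hj⟩ (basisP k r 0), by simp⟩
      · rw [hy0 j (by omega)]
        exact Submodule.zero_mem _
    rw [← hF]
    exact LinearMap.finrank_le_finrank_of_surjective
      (f := (homCopiesP r fun j : Fin (s + 1) => hy j).restrictScalars k)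
      (by simpa using LinearMap.range_eq_top.mp hsurj)
  · have hπ : Function.Surjective (homCopiesP r fun j : Fin (s + 1) => hx.isEigen j) := by
      rw [← LinearMap.range_eq_top, eq_top_iff, ← hx.span_eq_top, Submodule.span_le]
      rintro _ ⟨j, rfl⟩
      by_cases hj : j < s + 1
      · exact ⟨Pi.single ⟨j, hj⟩ (basisP k r 0), by simp⟩
      · rw [hx.eq_zero j (by omega)]
        exact Submodule.zero_mem _
    have := hf.projective
    obtain ⟨ψ, hψ⟩ := Module.projective_lifting_property _ f hπ
    have hψ' (q : Q) : homCopiesP r (fun j : Fin (s + 1) => hx.isEigen j) (ψ q) = f q :=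
      LinearMap.congr_fun hψ q
    have hker (j : Fin (s + 1)) : ∃ c : Fin (s + 1) → k,
        ψ (y j) = Pi.single j (basisP k r 0) + fun i => c i • basisP k r 3 := by
      have hu (i) : IsEigen (sgn k r) (ψ (y j) i) :=
        ((hy j).map ψ).map (LinearMap.proj i)
      choose c₀ c₃ hc using fun i => eq_of_isEigen_P r h2 (hu i)
      have h0 := hψ' (y j)
      rw [hfy, homCopiesP_apply] at h0
      simp only [hc, map_add, homP_smul, homP_basisP] at h0
      have h0' : ∑ i : Fin (s + 1), c₀ i • x i = x j := by
        rw [← h0]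
        refine Finset.sum_congr rfl fun i _ => ?_
        simp [hx.a_d hdet]
      have hli := Fintype.linearIndependent_iff.mp (hx.linearIndependent hdet)
        (fun i => c₀ i - if i = j then 1 else 0) (by
          simp [sub_smul, h0', ite_smul])
      refine ⟨c₃, ?_⟩
      funext i
      rw [hc i, sub_eq_zero.mp (hli i)]
      by_cases hij : i = j
      · subst hij; simp
      · simp [hij]
    have htop : LinearMap.range ψ = ⊤ := by
      choose c hc using hker
      -- The element `ad` kills the v₄ error terms and sends v₁ to v₄.
      have h3 (i) : Pi.single i (basisP k r 3) ∈ LinearMap.range ψ := by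
        refine ⟨gen k .a • gen k .d • y i, ?_⟩
        rw [map_smul, map_smul, hc]
        funext l
        by_cases hl : l = i
        · subst hl; simp [gen_smul_smul]
        · simp [hl, gen_smul_smul]
      refine eq_top_of_single_mem fun i => ?_
      have : (Pi.single i (basisP k r 0) : Fin (s + 1) → P k r) =
          ψ (y i) - ∑ l, c i l • Pi.single l (basisP k r 3) := by
        rw [hc, eq_sub_iff_add_eq]
        congr 1
        rw [← Finset.univ_sum_single (fun l => c i l • basisP k r 3)]
        exact Finset.sum_congr rfl fun l _ => (Pi.single_smul l _ _).symm
      rw [this]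
      refine Submodule.sub_mem _ ⟨_, rfl⟩ (Submodule.sum_mem _ fun l _ => ?_)
      exact ((LinearMap.range ψ).restrictScalars k).smul_mem _ (h3 l)
    rw [← hF]
    exact LinearMap.finrank_le_finrank_of_surjective (f := ψ.restrictScalars k)
      (by simpa using LinearMap.range_eq_top.mp htop)

/-- The top of the zigzag in the kernel of a projective cover. -/
noncomputable def kerTop (α β : k × k) (y : ℕ → Q) : ℕ → Q
  | 0 => lin β • y 0
  | j + 1 => lin β • y (j + 1) - lin α • y j

theorem kerTop_mem (hx : IsZigzag α β r s x) (hfy : ∀ j, f (y j) = x j) (j : ℕ) :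
    kerTop α β y j ∈ LinearMap.ker f := by
  cases j with
  | zero => simp [kerTop, hfy, hx.beta_zero]
  | succ j => simp [kerTop, hfy, hx.beta_succ]

/-- Modulo the submodule S generated by the proposed vectors, Q is spanned over k by the y_j and the
α y_j with j < s. Their images in N are linearly independent, so this span meets ker f only in 0; as
S lies in ker f, it must be all of ker f. -/
theorem span_kerTop (hx : IsZigzag α β r s x) (hdet : det α β = -1)
    (hf : IsProjectiveCover f) (hy : ∀ j, IsEigen (sgn k r) (y j)) (hy0 : ∀ j, s < j → y j = 0)
    (hfy : ∀ j, f (y j) = x j) :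
    Submodule.span (D4 k) (Set.range (kerTop α β y)) = LinearMap.ker f := by
  set S := Submodule.span (D4 k) (Set.range (kerTop α β y)) with hS
  have hSf : S ≤ LinearMap.ker f := by
    rw [hS, Submodule.span_le]
    rintro _ ⟨j, rfl⟩
    exact hx.kerTop_mem hfy j
  have hmem (j) : kerTop α β y j ∈ S := Submodule.subset_span ⟨j, rfl⟩
  refine le_antisymm hSf fun q hq => ?_
  set g : Fin (s + 1) ⊕ Fin s → Q :=
    Sum.elim (fun j : Fin (s + 1) => y j) fun j : Fin s => lin α • y j with hg
  set U : Submodule k Q := S.restrictScalars k ⊔ Submodule.span k (Set.range g) with hU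
  have hSU {z : Q} (hz : z ∈ S) : z ∈ U := Submodule.mem_sup_left hz
  have hyU (j) : y j ∈ U := by
    by_cases hj : j < s + 1
    · exact Submodule.mem_sup_right (Submodule.subset_span ⟨Sum.inl ⟨j, hj⟩, rfl⟩)
    · rw [hy0 j (by omega)]
      exact U.zero_mem
  have hαU (j) : lin α • y j ∈ U := by
    rcases lt_trichotomy j s with hj | rfl | hj
    · exact Submodule.mem_sup_right (Submodule.subset_span ⟨Sum.inr ⟨j, hj⟩, rfl⟩)
    -- As y_{s+1} = 0, the last vector of `kerTop`, at index s + 1, is -α y_s.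
    · refine hSU ?_
      have := hmem (j + 1)
      rwa [kerTop, hy0 (j + 1) (by omega), smul_zero, zero_sub, neg_mem_iff] at this
    · rw [hy0 j hj, smul_zero]
      exact U.zero_mem
  have hβU (j) : lin β • y j ∈ U := by
    cases j with
    | zero => exact hSU (hmem 0)
    | succ j =>
      have := U.add_mem (hSU (hmem (j + 1))) (hαU j)
      rwa [kerTop, sub_add_cancel] at this
  have hαβU (j) : lin α • lin β • y j ∈ U := by
    refine hSU ?_
    have := S.smul_mem (lin α) (hmem j)
    cases j with
    | zero => exact this
    | succ j => rwa [kerTop, smul_sub, (hy j).lin_lin_self (sgn_mul_self r), sub_zero] at this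
  have htop : U = ⊤ := by
    have hspan : Submodule.span (D4 k) (Set.range y) = ⊤ :=
      hx.eq_top_of_mem hf hfy fun j => Submodule.subset_span ⟨j, rfl⟩
    rw [eq_top_iff]
    rintro n -
    have hn : n ∈ Submodule.span (D4 k) (Set.range y) := by rw [hspan]; trivial
    induction hn using Submodule.closure_induction with
    | zero => exact U.zero_mem
    | add m n _ _ hm hn => exact U.add_mem hm hn
    | smul_mem h n hn =>
      obtain ⟨j, rfl⟩ := hn
      exact smul_mem_of_isEigen r (hy j) hdet (hyU j) (hαU j) (hβU j) (hαβU j) h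
  have hdisj : Disjoint (Submodule.span k (Set.range g)) (LinearMap.ker (f.restrictScalars k)) := by
    refine Submodule.range_ker_disjoint ?_
    convert hx.linearIndependent_family hdet using 1
    funext j
    rcases j with j | j <;> simp [hg, hfy]
  obtain ⟨z, hz, w, hw, rfl⟩ := Submodule.mem_sup.mp (show q ∈ U by rw [htop]; trivial)
  have hwf : w ∈ LinearMap.ker (f.restrictScalars k) := by
    have := (LinearMap.ker f).sub_mem hq (hSf hz)
    rwa [add_sub_cancel_left] at this
  rw [Submodule.disjoint_def.mp hdisj w hw hwf, add_zero]
  exact hz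

/-- The zigzag relation in the kernel is anticommutation: β(β y_{j+1} - α y_j) = αβ y_j = α(β y_j -
α y_{j-1}). The dimension is 4(s+1) - (2s+1) = 2(s+1) + 1. -/
theorem ker_cover (h2 : (2 : k) ≠ 0) (hx : IsZigzag α β r s x) (hdet : det α β = -1)
    (hf : IsProjectiveCover f) :
    ∃ x' : ℕ → LinearMap.ker f, IsZigzag α β (r + 1) (s + 1) x' := by
  -- Lifts beyond s must be 0 itself, not just elements of the kernel, so that the new zigzag stops
  -- at s + 1.
  have hex (j) : ∃ q, IsEigen (sgn k r) q ∧ f q = x j ∧ (s < j → q = 0) := by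
    by_cases hj : s < j
    · exact ⟨0, IsEigen.zero _, by rw [map_zero, hx.eq_zero j hj], fun _ => rfl⟩
    · obtain ⟨q, hq, hfq⟩ := exists_isEigen_lift h2 hf.surjective (sgn_mul_self r) (hx.isEigen j)
      exact ⟨q, hq, hfq, fun h => absurd h hj⟩
  choose y hy hfy hy0 using hex
  have hβ (j) : lin β • kerTop α β y (j + 1) = lin α • kerTop α β y j := by
    have h1 := (hy j).lin_lin_comm (sgn_mul_self r) α β
    have h2 := (hy (j + 1)).lin_lin_self (sgn_mul_self r) β
    cases j with
    | zero => rw [kerTop, kerTop, smul_sub, h1, h2, zero_sub, neg_neg]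
    | succ j =>
      rw [kerTop, kerTop, smul_sub, smul_sub, h1, h2, (hy j).lin_lin_self (sgn_mul_self r),
        zero_sub, neg_neg, sub_zero]
  refine ⟨fun j => ⟨kerTop α β y j, hx.kerTop_mem hfy j⟩, ?_, ?_, ?_, ?_, ?_, ?_⟩
  · intro j
    have : IsEigen (sgn k (r + 1)) (kerTop α β y j) := by
      rw [sgn_succ]
      cases j with
      | zero => exact (hy 0).lin_smul β
      | succ j => exact ((hy (j + 1)).lin_smul β).sub ((hy j).lin_smul α)
    exact ⟨Subtype.ext this.1, Subtype.ext this.2⟩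
  · intro j hj
    obtain ⟨j, rfl⟩ : ∃ i, j = i + 1 := ⟨j - 1, by omega⟩
    refine Subtype.ext ?_
    change kerTop α β y (j + 1) = 0
    rw [kerTop, hy0 _ (by omega), hy0 _ (by omega), smul_zero, smul_zero, sub_zero]
  · exact Subtype.ext ((hy 0).lin_lin_self (sgn_mul_self r) β)
  · exact fun j => Subtype.ext (hβ j)
  · refine Submodule.map_injective_of_injective (LinearMap.ker f).injective_subtype ?_
    rw [Submodule.map_span, Submodule.map_subtype_top, ← Set.range_comp]
    exact hx.span_kerTop hdet hf hy hy0 hfy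
  · have := LinearMap.finrank_range_add_finrank_ker (f.restrictScalars k)
    rw [LinearMap.range_eq_top.mpr (by simpa using hf.surjective), finrank_top, hx.finrank_eq,
      hx.finrank_cover h2 hdet hf hy hy0 hfy] at this
    change Module.finrank k (LinearMap.ker (f.restrictScalars k)) = _
    omega

end Cover

theorem exists_simple (r : ZMod 2) : ∃ x : ℕ → V k r, IsZigzag α β r 0 x := by
  set B : Module.Basis (Fin 1) k (V k r) := stdBasis (actV r) (relations_V r) with hB
  have hg (x : Gen) : gen k x • B 0 = (actV r x 0 : Fin 1 → k) := gen_smul_stdBasis _ _ _ _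
  have hB0 : B 0 = (e 0 : Fin 1 → k) := stdBasis_apply _ _ _
  have ha : gen k .a • B 0 = 0 := hg .a
  have hd : gen k .d • B 0 = 0 := hg .d
  have hl (γ : k × k) : lin γ • B 0 = 0 := by rw [D4.lin_smul, ha, hd]; simp
  have he : IsEigen (sgn k r) (B 0) := by constructor <;> rw [hg, hB0] <;> rfl
  refine ⟨fun j => if j = 0 then B 0 else 0, ?_, ?_, ?_, ?_, ?_, ?_⟩
  · intro j
    split_ifs
    exacts [he, IsEigen.zero _]
  · intro j hj
    rw [if_neg hj.ne']
  · exact hl β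
  · intro j
    rw [if_neg (Nat.succ_ne_zero j), smul_zero]
    split_ifs
    exacts [(hl α).symm, (smul_zero _).symm]
  · rw [eq_top_iff]
    rintro v -
    have hv := B.sum_repr v
    rw [Fin.sum_univ_one] at hv
    rw [← hv]
    refine ((Submodule.span (D4 k) _).restrictScalars k).smul_mem _ ?_
    exact Submodule.subset_span ⟨0, rfl⟩
  · rw [Module.finrank_eq_card_basis B, Fintype.card_fin]

/-- Each syzygy flips the sign on the top, whence r + s. The pair α, β is arbitrary, so that one
syzygy can be matched with every η. -/
theorem exists_omega (h2 : (2 : k) ≠ 0) (hdet : det α β = -1) (r : ZMod 2) (s : ℕ) :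
    ∃ x : ℕ → Omega s (V k r), IsZigzag α β (r + s) s x := by
  induction s with
  | zero =>
    rw [Nat.cast_zero, add_zero]
    exact exists_simple r
  | succ s ih =>
    obtain ⟨x, hx⟩ := ih
    obtain ⟨x', hx'⟩ := hx.ker_cover h2 hdet (coverMap_isProjectiveCover _)
    rw [add_assoc, ← Nat.cast_succ] at hx'
    exact ⟨x', hx'⟩

end IsZigzag

end D4Mod

/-! ### The modules M_t(r, η) in adapted coordinates -/

namespace D4Mod

open D4

section Tube

variable {k : Type u} [Field k]

/-- The pair `α, β` of linear combinations of `a` and `d` for which `α v_i = w_i` and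
`β v_i = w_{i-1}` in `M_t(r, η)`. -/
def pencil (η : OnePoint k) : (k × k) × (k × k) :=
  η.elim ((0, 1), (1, 0)) fun x => ((1, 0), (-x, -1))

theorem det_pencil (η : OnePoint k) : det (pencil η).1 (pencil η).2 = -1 := by
  induction η using OnePoint.rec <;> simp [pencil, det]

/-- The basis `v_0, …, v_{t-1}, w_0, …, w_{t-1}` of `M_t(r, η)`. -/
noncomputable def basisM (t : ℕ) (r : ZMod 2) (η : OnePoint k) :
    Module.Basis (Fin t ⊕ Fin t) k (M t r η) :=
  stdBasis (actM t r η) (relations_M t r η)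

variable {t : ℕ} {r : ZMod 2} {η : OnePoint k}

theorem gen_smul_basisM (x : Gen) (i : Fin t ⊕ Fin t) :
    gen k x • basisM t r η i = (actM t r η x i : Fin t ⊕ Fin t → k) :=
  gen_smul_stdBasis _ _ x i

theorem basisM_apply (i : Fin t ⊕ Fin t) :
    basisM t r η i = (e i : Fin t ⊕ Fin t → k) :=
  stdBasis_apply _ _ i

/-- The vector `w_{i-1}` of `M_t(r, η)`, with `w_{-1} = 0`. -/
noncomputable def wPredM (t : ℕ) (r : ZMod 2) (η : OnePoint k) (i : Fin t) : M t r η :=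
  if i.val = 0 then 0 else basisM t r η (Sum.inr ⟨i.val - 1, by omega⟩)

theorem wPredM_eq (i : Fin t) : wPredM t r η i = (wPred i : Fin t ⊕ Fin t → k) := by
  unfold wPredM wPred
  split_ifs
  · rfl
  · exact basisM_apply _

theorem a_smul_basisM_infty (i : Fin t) :
    gen k .a • basisM t r (.infty : OnePoint k) (Sum.inl i) = wPredM t r (.infty : OnePoint k) i :=
  (gen_smul_basisM _ _).trans (wPredM_eq i).symm

theorem d_smul_basisM_infty (i : Fin t) :
    gen k .d • basisM t r (.infty : OnePoint k) (Sum.inl i) = basisM t r (.infty : OnePoint k) (Sum.inr i) :=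
  (gen_smul_basisM _ _).trans (basisM_apply (Sum.inr i)).symm

theorem a_smul_basisM_coe (x : k) (i : Fin t) :
    gen k .a • basisM t r (x : OnePoint k) (Sum.inl i) = basisM t r (x : OnePoint k) (Sum.inr i) :=
  (gen_smul_basisM _ _).trans (basisM_apply (Sum.inr i)).symm

theorem d_smul_basisM_coe (x : k) (i : Fin t) :
    gen k .d • basisM t r (x : OnePoint k) (Sum.inl i) = -(x • basisM t r (x : OnePoint k) (Sum.inr i)) - wPredM t r (x : OnePoint k) i := by
  rw [gen_smul_basisM, basisM_apply, wPredM_eq]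
  rfl

theorem alpha_smul_basisM (i : Fin t) :
    lin (pencil η).1 • basisM t r η (Sum.inl i) = basisM t r η (Sum.inr i) := by
  rw [lin_smul]
  induction η using OnePoint.rec with
  | infty => simp [d_smul_basisM_infty, pencil]
  | coe x => simp [a_smul_basisM_coe, pencil]

theorem beta_smul_basisM (i : Fin t) :
    lin (pencil η).2 • basisM t r η (Sum.inl i) = wPredM t r η i := by
  rw [lin_smul]
  induction η using OnePoint.rec with
  | infty => simp [a_smul_basisM_infty, pencil]
  | coe x => simp [a_smul_basisM_coe, d_smul_basisM_coe, pencil]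

theorem isEigen_basisM_inl (i : Fin t) :
    IsEigen (sgn k (r + 1)) (basisM t r η (Sum.inl i)) := by
  constructor <;> rw [gen_smul_basisM, basisM_apply] <;> rfl

theorem isEigen_basisM_inr (i : Fin t) :
    IsEigen (sgn k r) (basisM t r η (Sum.inr i)) := by
  constructor <;> rw [gen_smul_basisM, basisM_apply] <;> rfl

theorem lin_smul_basisM_inr (γ : k × k) (i : Fin t) :
    lin γ • basisM t r η (Sum.inr i) = 0 := by
  rw [lin_smul, gen_smul_basisM, gen_smul_basisM]
  change γ.1 • (0 : Fin t ⊕ Fin t → k) + γ.2 • (0 : Fin t ⊕ Fin t → k) = 0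
  simp

variable {N : Type*} [AddCommGroup N] [Module k N] [Module (D4 k) N] [IsScalarTower k (D4 k) N]

/-- A `k`-linear map that commutes with `α`, `β`, `b` and `c` on a basis is `D₄`-linear. -/
theorem map_gen_smul_of_lin {N' : Type*} [AddCommGroup N'] [Module k N'] [Module (D4 k) N']
    [IsScalarTower k (D4 k) N'] {ι : Type*} [Finite ι] (B : Module.Basis ι k N) (f : N →ₗ[k] N')
    {α β : k × k} (hdet : det α β = -1)
    (hα : ∀ i, f (lin α • B i) = lin α • f (B i)) (hβ : ∀ i, f (lin β • B i) = lin β • f (B i))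
    (hB : ∀ i, ∃ σ : k, IsEigen σ (B i) ∧ IsEigen σ (f (B i))) (x : Gen) (n : N) :
    f (gen k x • n) = gen k x • f n := by
  refine map_gen_smul_of_basis B f (fun x i => ?_) x n
  obtain ⟨σ, h, h'⟩ := hB i
  cases x with
  | a => rw [a_smul_eq hdet, a_smul_eq hdet, f.map_sub, f.map_smul, f.map_smul, hα, hβ]
  | b => rw [h.1, h'.1, map_smul]
  | c => rw [h.2, h'.2, map_smul]
  | d => rw [d_smul_eq hdet, d_smul_eq hdet, f.map_sub, f.map_smul, f.map_smul, hα, hβ]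

/-- The map `M_t(r, η) → N` that sends `v_i` to given eigenvectors `z i` with `β z_0 = 0` and
`β z_{i+1} = α z_i`. -/
theorem exists_homM {z : ℕ → N} (hz : ∀ i, IsEigen (sgn k (r + 1)) (z i))
    (h0 : lin (pencil η).2 • z 0 = 0)
    (hs : ∀ i, i + 1 < t → lin (pencil η).2 • z (i + 1) = lin (pencil η).1 • z i) :
    ∃ f : M t r η →ₗ[D4 k] N, ∀ i : Fin t, f (basisM t r η (Sum.inl i)) = z i := by
  have hinl (i : Fin t) := (basisM t r η).constr_basis k
    (Sum.elim (fun i : Fin t => z i) fun i : Fin t => lin (pencil η).1 • z i) (Sum.inl i)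
  have hinr (i : Fin t) := (basisM t r η).constr_basis k
    (Sum.elim (fun i : Fin t => z i) fun i : Fin t => lin (pencil η).1 • z i) (Sum.inr i)
  simp only [Sum.elim_inl, Sum.elim_inr] at hinl hinr
  generalize (basisM t r η).constr k
    (Sum.elim (fun i : Fin t => z i) fun i : Fin t => lin (pencil η).1 • z i) = f at hinl hinr
  have hσ := sgn_mul_self (k := k) (r + 1)
  -- By anticommutation this also gives βα z_i = 0, as needed because w_i ↦ α z_i and β w_i = 0.
  have hzero (i : ℕ) (hi : i < t) : lin (pencil η).1 • lin (pencil η).2 • z i = 0 := by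
    cases i with
    | zero => rw [h0, smul_zero]
    | succ i => rw [hs i hi, (hz i).lin_lin_self hσ]
  refine ⟨linearMapOfGen f (map_gen_smul_of_lin (basisM t r η) f (det_pencil η) ?_ ?_ ?_), hinl⟩
  · rintro (i | i)
    · rw [alpha_smul_basisM, hinl, hinr]
    · rw [lin_smul_basisM_inr, hinr, (hz i).lin_lin_self hσ, map_zero]
  · rintro (i | i)
    · rw [beta_smul_basisM, hinl, wPredM]
      obtain ⟨i, hi⟩ := i
      cases i with
      | zero => simp [h0]
      | succ i => simp [hinr, hs i hi]
    · rw [lin_smul_basisM_inr, hinr, (hz i).lin_lin_comm hσ, hzero i i.2, map_zero, neg_zero]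
  · rintro (i | i)
    · exact ⟨_, isEigen_basisM_inl i, by rw [hinl]; exact hz i⟩
    · refine ⟨_, isEigen_basisM_inr i, ?_⟩
      rw [hinr, ← neg_neg (sgn k r), ← sgn_succ]
      exact (hz i).lin_smul _

/-- The vectors `v_0, …, v_{t-1}` are a tube `β v_{i+1} = α v_i` that generates `N`, where `b`
and `c` act on them by `(-1)^{r+1}`. -/
structure IsTube (α β : k × k) (r : ZMod 2) (t : ℕ) (v : ℕ → N) : Prop where
  isEigen : ∀ i, IsEigen (sgn k (r + 1)) (v i)
  beta_zero : lin β • v 0 = 0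
  -- Unlike in a zigzag, nothing is imposed on α v_{t-1}, which is nonzero in M_t(r, η).
  beta_succ : ∀ i, i + 1 < t → lin β • v (i + 1) = lin α • v i
  eq_top : ∀ U : Submodule k N, (∀ i < t, v i ∈ U) → (∀ i < t, lin α • v i ∈ U) → U = ⊤

theorem exists_isTube (t : ℕ) (r : ZMod 2) (η : OnePoint k) :
    ∃ v : ℕ → M t r η, IsTube (pencil η).1 (pencil η).2 r t v := by
  refine ⟨fun i => if h : i < t then basisM t r η (Sum.inl ⟨i, h⟩) else 0, ?_, ?_, ?_, ?_⟩
  · intro i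
    split_ifs
    exacts [isEigen_basisM_inl _, IsEigen.zero _]
  · split_ifs
    · rw [beta_smul_basisM, wPredM, if_pos rfl]
    · exact smul_zero _
  · intro i hi
    rw [dif_pos hi, dif_pos (by omega), beta_smul_basisM, alpha_smul_basisM, wPredM,
      if_neg (Nat.succ_ne_zero i)]
    rfl
  · intro U h hα
    rw [eq_top_iff, ← (basisM t r η).span_eq, Submodule.span_le]
    rintro _ ⟨i | i, rfl⟩
    · have := h i i.2
      rwa [dif_pos i.2] at this
    · have := hα i i.2
      rwa [dif_pos i.2, alpha_smul_basisM] at this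

theorem finrank_M : Module.finrank k (M t r η) = 2 * t := by
  rw [Module.finrank_eq_card_basis (basisM t r η), Fintype.card_sum, Fintype.card_fin, two_mul]

end Tube

/-! ### The action on tensor products -/

section Tensor

variable {k : Type u} [Field k] {A E : D4Mod k}

/-- A pure tensor as an element of the tensor product of modules. -/
noncomputable def tmul : A →ₗ[k] E →ₗ[k] A.tensor E := TensorProduct.mk k A E

theorem gen_smul_tmul (x : Gen) (m : A) (n : E) :
    gen k x • tmul m n = (Module.endTensorEndAlgHom (R := k) (S := k) (A := k) (M := A) (N := E)
      (Algebra.TensorProduct.map (Algebra.lsmul k k A) (Algebra.lsmul k k E) (comulGen k x)) :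
        Module.End k (A ⊗[k] E)) (m ⊗ₜ n) := by
  rw [← lift_gen (k := k) (comulGen k) (comulGen_relations k) x]
  rfl

theorem a_smul_tmul (m : A) (n : E) :
    gen k .a • tmul m n = tmul (gen k .a • m) (gen k .b • n) + tmul m (gen k .a • n) := by
  rw [gen_smul_tmul, comulGen, map_add, map_add, LinearMap.add_apply,
    Algebra.TensorProduct.map_tmul, Algebra.TensorProduct.map_tmul, map_one]
  rfl

theorem b_smul_tmul (m : A) (n : E) :
    gen k .b • tmul m n = tmul (gen k .b • m) (gen k .b • n) := by
  rw [gen_smul_tmul, comulGen, Algebra.TensorProduct.map_tmul]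
  rfl

theorem c_smul_tmul (m : A) (n : E) :
    gen k .c • tmul m n = tmul (gen k .c • m) (gen k .c • n) := by
  rw [gen_smul_tmul, comulGen, Algebra.TensorProduct.map_tmul]
  rfl

theorem d_smul_tmul (m : A) (n : E) :
    gen k .d • tmul m n = tmul (gen k .d • m) (gen k .c • n) + tmul m (gen k .d • n) := by
  rw [gen_smul_tmul, comulGen, map_add, map_add, LinearMap.add_apply,
    Algebra.TensorProduct.map_tmul, Algebra.TensorProduct.map_tmul, map_one]
  rfl

/-- The factors `b` and `c` in the coproducts of `a` and `d` act on n by the same scalar, so every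
combination of `a` and `d` obeys one twisted Leibniz rule. -/
theorem lin_smul_tmul {σ : k} {n : E} (hn : IsEigen σ n) (γ : k × k) (m : A) :
    lin γ • tmul m n = σ • tmul (lin γ • m) n + tmul m (lin γ • n) := by
  simp only [lin_smul, a_smul_tmul, d_smul_tmul, hn.1, hn.2, map_add, map_smul, LinearMap.add_apply,
    LinearMap.smul_apply]
  module

theorem isEigen_tmul {σ τ : k} {m : A} {n : E} (hm : IsEigen σ m) (hn : IsEigen τ n) :
    IsEigen (σ * τ) (tmul m n) := by
  constructor
  · rw [b_smul_tmul, hm.1, hn.1, map_smul, map_smul, LinearMap.smul_apply, smul_smul, mul_comm]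
  · rw [c_smul_tmul, hm.2, hn.2, map_smul, map_smul, LinearMap.smul_apply, smul_smul, mul_comm]

theorem tensor_eq_top {U : Submodule k (A.tensor E)} (h : ∀ m n, tmul m n ∈ U) : U = ⊤ := by
  rw [eq_top_iff]
  rintro z -
  change A ⊗[k] E at z
  induction z using TensorProduct.induction_on with
  | zero => exact U.zero_mem
  | tmul m n => exact h m n
  | add z w hz hw => exact U.add_mem hz hw

theorem finrank_tensor :
    Module.finrank k (A.tensor E) = Module.finrank k A * Module.finrank k E :=
  Module.finrank_tensorProduct (R := k) (S := k)

end Tensor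

end D4Mod

/-! ### Antidiagonal sums and the decomposition -/

namespace D4Mod

open D4

section Decomposition

variable {k : Type u} [Field k] {A E : D4Mod k}

/-- The antidiagonal sum `∑ l ≤ i, v (i - l) ⊗ x (j + l)`. -/
noncomputable def antidiag (v : ℕ → A) (x : ℕ → E) : ℕ → ℕ → A.tensor E
  | 0, j => tmul (v 0) (x j)
  | i + 1, j => tmul (v (i + 1)) (x j) + antidiag v x i (j + 1)

variable {α β : k × k} {r r' : ZMod 2} {s t : ℕ} {v : ℕ → A} {x : ℕ → E}

theorem isEigen_antidiag (hv : IsTube α β r t v) (hx : IsZigzag α β r' s x) (i j : ℕ) :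
    IsEigen (sgn k (r + 1) * sgn k r') (antidiag v x i j) := by
  induction i generalizing j with
  | zero => exact isEigen_tmul (hv.isEigen 0) (hx.isEigen j)
  | succ i ih => exact (isEigen_tmul (hv.isEigen (i + 1)) (hx.isEigen j)).add (ih (j + 1))

theorem antidiag_eq_zero (hx : IsZigzag α β r' s x) (i : ℕ) {j : ℕ} (hj : s < j) :
    antidiag v x i j = 0 := by
  induction i generalizing j with
  | zero => rw [antidiag, hx.eq_zero j hj, map_zero]
  | succ i ih => rw [antidiag, hx.eq_zero j hj, map_zero, ih (by omega), add_zero]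

/-- Moving β across a summand lowers an index on either side: β v_{i+1} = α v_i and β x_{j+1} = α
x_j. The shifted terms reassemble to α of the previous antidiagonal sum, except the term in β x_j,
which vanishes for j = 0. -/
theorem beta_antidiag (hv : IsTube α β r t v) (hx : IsZigzag α β r' s x) (i j : ℕ)
    (hi : i + 1 < t) : lin β • antidiag v x (i + 1) j =
      lin α • antidiag v x i j + tmul (v (i + 1)) (lin β • x j) := by
  induction i generalizing j with
  | zero =>
    simp only [antidiag, smul_add, lin_smul_tmul (hx.isEigen _), hv.beta_succ 0 hi, hv.beta_zero,
      hx.beta_succ, map_zero, LinearMap.zero_apply, smul_zero]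
    abel
  | succ i ih =>
    rw [antidiag, smul_add, ih _ (by omega), antidiag, smul_add]
    simp only [lin_smul_tmul (hx.isEigen _), hv.beta_succ _ hi, hx.beta_succ]
    abel

/-- A `D₄`-submodule of the tensor product containing the antidiagonal sums is everything. -/
theorem eq_top_of_antidiag_mem (hdet : det α β = -1) (hv : IsTube α β r t v)
    (hx : IsZigzag α β r' s x) {R : Submodule (D4 k) (A.tensor E)}
    (h : ∀ i j, i < t → antidiag v x i j ∈ R) : R = ⊤ := by
  have hs : sgn k r' ≠ 0 := fun h => by simpa [h] using sgn_mul_self (k := k) r'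
  have hσ {z : A.tensor E} (hz : sgn k r' • z ∈ R) : z ∈ R :=
    ((R.restrictScalars k).smul_mem_iff hs).mp hz
  have hvx (i j : ℕ) (hi : i < t) : tmul (v i) (x j) ∈ R := by
    cases i with
    | zero => exact h 0 j hi
    | succ i =>
      have := R.sub_mem (h (i + 1) j hi) (h i (j + 1) (by omega))
      rwa [antidiag, add_sub_cancel_right] at this
  have hα (i j : ℕ) (hi : i < t) :
      sgn k r' • tmul (lin α • v i) (x j) + tmul (v i) (lin α • x j) ∈ R := by
    rw [← lin_smul_tmul (hx.isEigen j)]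
    exact R.smul_mem _ (hvx i j hi)
  have hβ (i j : ℕ) (hi : i < t) :
      sgn k r' • tmul (lin β • v i) (x j) + tmul (v i) (lin β • x j) ∈ R := by
    rw [← lin_smul_tmul (hx.isEigen j)]
    exact R.smul_mem _ (hvx i j hi)
  -- Subtracting β(v_i ⊗ x_{j+1}) from α(v_i ⊗ x_j) cancels v_i ⊗ α x_j. What remains is, up to
  -- sign, α v_i ⊗ x_j - β v_i ⊗ x_{j+1}, whose second term is 0 or α v_{i-1} ⊗ x_{j+1}.
  have hwx (i j : ℕ) (hi : i < t) : tmul (lin α • v i) (x j) ∈ R := by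
    refine hσ ?_
    induction i generalizing j with
    | zero =>
      have := hβ 0 (j + 1) hi
      rw [hv.beta_zero, hx.beta_succ, map_zero, LinearMap.zero_apply, smul_zero, zero_add] at this
      exact (add_mem_cancel_right this).mp (hα 0 j hi)
    | succ i ih =>
      have := hβ (i + 1) (j + 1) hi
      rw [hv.beta_succ i hi, hx.beta_succ, add_mem_cancel_left (ih (j + 1) (by omega))] at this
      exact (add_mem_cancel_right this).mp (hα (i + 1) j hi)
  have hvy (i j : ℕ) (hi : i < t) : tmul (v i) (lin α • x j) ∈ R :=
    (add_mem_cancel_left ((R.restrictScalars k).smul_mem _ (hwx i j hi))).mp (hα i j hi)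
  have hwy (i j : ℕ) (hi : i < t) : tmul (lin α • v i) (lin α • x j) ∈ R := by
    have := R.smul_mem (lin α) (hwx i j hi)
    rw [lin_smul_tmul (hx.isEigen j), (hv.isEigen i).lin_lin_self (sgn_mul_self _), map_zero,
      LinearMap.zero_apply, smul_zero, zero_add] at this
    exact this
  have hleft (m : A) (hmx : ∀ j, tmul m (x j) ∈ R) (hmy : ∀ j, tmul m (lin α • x j) ∈ R) (n : E) :
      tmul m n ∈ R := by
    have : (R.restrictScalars k).comap (tmul m) = ⊤ := hx.eq_top hdet hmx hmy
    exact this.ge (Submodule.mem_top (x := n))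
  have htop : R.restrictScalars k = ⊤ := by
    refine tensor_eq_top fun m n => ?_
    have : (R.restrictScalars k).comap (tmul.flip n) = ⊤ :=
      hv.eq_top _ (fun i hi => hleft _ (hvx i · hi) (hvy i · hi) n)
        fun i hi => hleft _ (hwx i · hi) (hwy i · hi) n
    exact this.ge (Submodule.mem_top (x := m))
  exact (Submodule.restrictScalars_eq_top_iff k (D4 k) _).mp htop

/-- The tensor product of `M_t(r, η)` and a zigzag module is the direct sum of a projective module
and some `M_t(r, η)`. -/
theorem iso_of_isZigzag {η : OnePoint k} {x : ℕ → E}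
    (hx : IsZigzag (pencil η).1 (pencil η).2 r' s x) :
    Iso ((M t r η).tensor E) (((P k (r + r' + 1)).copies (s * t)).sum (M t (r + r') η)) := by
  obtain ⟨v, hv⟩ := exists_isTube t r η
  have hsgn : sgn k (r + 1) * sgn k r' = sgn k (r + r' + 1) := by
    have hadd (r r' : ZMod 2) : sgn k (r + r') = sgn k r * sgn k r' := by
      fin_cases r'
      · change sgn k (r + 0) = sgn k r * (-1) ^ 0
        simp
      · change sgn k (r + 1) = sgn k r * (-1) ^ 1
        rw [sgn_succ]
        ring
    rw [hadd (r + r'), hadd r, hadd r]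
    ring
  have he (i j) := isEigen_antidiag hv hx i j
  rw [hsgn] at he
  obtain ⟨f, hf⟩ := exists_homM (t := t) (r := r + r') (η := η) (z := fun i => antidiag v x i 0)
    (fun i => he i 0)
    (by rw [antidiag, lin_smul_tmul (hx.isEigen _), hv.beta_zero, hx.beta_zero]; simp)
    (fun i hi => by rw [beta_antidiag hv hx i 0 hi, hx.beta_zero, map_zero, add_zero])
  -- The second index is shifted by one because the sums with j = 0 generate the image of M_t.
  let g := homCopiesP (r + r' + 1) (n := s * t)
    (z := fun p => antidiag v x (finProdFinEquiv.symm p).2 ((finProdFinEquiv.symm p).1 + 1))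
    fun p => he _ _
  let G : (Fin (s * t) → P k (r + r' + 1)) × M t (r + r') η →ₗ[D4 k] (M t r η).tensor E :=
    g.coprod f
  have hsurj : LinearMap.range G = ⊤ := by
    refine eq_top_of_antidiag_mem (det_pencil η) hv hx fun i j hi => ?_
    cases j with
    | zero => exact ⟨(0, basisM t (r + r') η (Sum.inl ⟨i, hi⟩)), by simp [G, hf]⟩
    | succ j =>
      by_cases hj : j < s
      · exact ⟨(Pi.single (finProdFinEquiv (⟨j, hj⟩, ⟨i, hi⟩)) (basisP k _ 0), 0), by
          simp only [G, g, LinearMap.coprod_apply, map_zero, add_zero, homCopiesP_single,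
            homP_basisP, Equiv.symm_apply_apply]
          rfl⟩
      · rw [antidiag_eq_zero hx i (by omega)]
        exact Submodule.zero_mem _
  have hdim : Module.finrank k ((Fin (s * t) → P k (r + r' + 1)) × M t (r + r') η) =
      Module.finrank k ((M t r η).tensor E) := by
    rw [finrank_tensor, finrank_M, hx.finrank_eq, Module.finrank_prod, finrank_M,
      Module.finrank_pi_fintype]
    simp only [finrank_P, Finset.sum_const, Finset.card_univ, Fintype.card_fin, smul_eq_mul]
    ring
  have hsurj' := LinearMap.range_eq_top.mp hsurj
  have hinj : Function.Injective G :=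
    (LinearMap.injective_iff_surjective_of_finrank_eq_finrank
      (f := G.restrictScalars k) hdim).mpr hsurj'
  exact ⟨(LinearEquiv.ofBijective G ⟨hinj, hsurj'⟩).symm⟩

end Decomposition

end D4Mod

theorem corollary2p22 {k : Type u} [Field k] [IsAlgClosed k] (hk : ringChar k ≠ 2)
    (s t : ℕ) (hs : 1 ≤ s) (ht : 1 ≤ t) (r r' : ZMod 2) (η : OnePoint k) :
    (Odd s →
      D4Mod.Iso ((D4Mod.M t r η).tensor (D4Mod.Omega s (D4Mod.V k r')))
        (((D4Mod.P k (r + r')).copies (s * t)).sum (D4Mod.M t (r + r' + 1) η))) ∧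
    (Even s →
      D4Mod.Iso ((D4Mod.M t r η).tensor (D4Mod.Omega s (D4Mod.V k r')))
        (((D4Mod.P k (r + r' + 1)).copies (s * t)).sum (D4Mod.M t (r + r') η))) := by
  obtain ⟨x, hx⟩ := D4Mod.IsZigzag.exists_omega (Ring.two_ne_zero hk) (D4Mod.det_pencil η) r' s
  have h := D4Mod.iso_of_isZigzag (t := t) (r := r) hx
  constructor
  · intro hodd
    -- The zigzag sign is r' + s, so for odd s the index of P is r + r' + 1 + 1 = r + r'.
    rw [ZMod.natCast_eq_one_iff_odd.mpr hodd, ← add_assoc, add_assoc (r + r') 1 1,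
      CharTwo.add_self_eq_zero, add_zero] at h
    exact h
  · intro heven
    rw [ZMod.natCast_eq_zero_iff_even.mpr heven, add_zero] at h
    exact h
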